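/- Let $\ell\in\mathbb{N}=\{0,1,2,\dots\}$, $\beta\in[0,1)$ and $\sigma\in(-\infty,\tfrac12)$ be fixed, and let $\zeta^{(\ell)}$ denote the $\ell$-th derivative of the Riemann zeta function. Then, as $T\to\infty$, $$\max_{T^{\beta}\le t\le T}\bigl|\zeta^{(\ell)}(\sigma+it)\bigr| \;\ge\; (1+o(1))\,(2\pi)^{\sigma-\frac12}\sqrt{\frac{\zeta(2-2\sigma)}{2-2\sigma}}\;T^{\frac12-\sigma}(\log T)^{\ell},$$ where $o(1)$ denotes a real function of $T$ (which may depend on $\ell,\beta,\sigma$) tending to $0$ as $T\to\infty$. -/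

import Mathlib

open Filter Topology Set

/-! The proof is a resonance argument with a test function tuned to the integers. Put T = 2πX. Let b
be a smooth cutoff supported just below 1 and f(y) = ∑ c_m b(my) e^{-iTmy}, m ≤ N. At y = n/X every
phase e^{-2πimn} equals 1 (`res_natCast`), so ∑ (log n)^ℓ f(n/X) has no cancellation: it is at least
about X (log T)^ℓ |plateau of b| ∑ c_m/m (`exists_hasSum_ge`).

By Mellin inversion the same sum is, up to sign, (2π)⁻¹ ∫ ζ^(ℓ)(s) X^s f̃(s) dt on a line Re s > 1,
with f̃ the Mellin transform of f (`hasSum_log_pow_mul_b`). The line is moved to Re s = σ for the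
entire part of ζ^(ℓ), while the polar part is merely estimated on both lines. The phase t log y - Ty
is stationary at y = t/T, so f̃ is negligible unless t lies in a window [wT, T] just wider than the
support of b (`exists_norm_mellin_res_le`). If |ζ^(ℓ)| ≤ M on the window, Cauchy–Schwarz and
Plancherel bound the integral by X^σ M √((1-w)T) times the L² norm of f̃. The dilates of b are
disjoint, so that norm has only diagonal terms (`integral_norm_mellin_res_sq`). The outcome is
`exists_resonance_inequality`.

With c_m = m^{2σ-1} and b close to the indicator of [w, 1], comparison of the two estimates gives M
≥ √κ X^{1/2-σ} (log T)^ℓ for large T and any fixed 0 ≤ κ < ζ(2-2σ). Since 2-2σ > 1, κ =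
ζ(2-2σ)/(2-2σ) is allowed, so the bound holds even with o(1) = 0. As β < 1, the window lies in [T^β,
T] for large T.

The analytic inputs are polynomial growth of ζ minus its pole, from iterated Euler–Maclaurin
summation (`exists_norm_riemannZeta₀_le`), and repeated integration by parts
(`exists_norm_oscIntegral_le`). -/

/-! ### Euler–Maclaurin summation and polynomial growth of ζ(s) - 1/(s-1). -/

/-- Periodic Euler–Maclaurin summand on `[n + 1, n + 2]` with kernel `q`. -/
noncomputable def eulerMaclaurinTerm (q : ℝ → ℝ) (n : ℕ) (s : ℂ) : ℂ :=
  ∫ u in (0 : ℝ)..1, (q u : ℂ) * ((n + 1 + u : ℝ) : ℂ) ^ (-s)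

lemma norm_natCast_add_cpow_le {n : ℕ} {u : ℝ} (hu : 0 ≤ u) {s : ℂ} (hs : 0 ≤ s.re) :
    ‖((n + 1 + u : ℝ) : ℂ) ^ (-s)‖ ≤ ((n + 1 : ℝ)) ^ (-s.re) := by
  have h1 : (0 : ℝ) < n + 1 := by positivity
  rw [Complex.norm_cpow_eq_rpow_re_of_pos (by linarith)]
  exact Real.rpow_le_rpow_of_nonpos h1 (by linarith) (by simpa using hs)

lemma continuousOn_eulerMaclaurinTerm_integrand {q : ℝ → ℝ} (hq : Continuous q) (n : ℕ) (s : ℂ) :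
    ContinuousOn (fun u : ℝ => (q u : ℂ) * ((n + 1 + u : ℝ) : ℂ) ^ (-s)) (Icc 0 1) := by
  refine ContinuousOn.mul (by fun_prop) ?_
  refine ContinuousOn.cpow (by fun_prop) (by fun_prop) fun u hu => ?_
  left
  simp only [Complex.ofReal_re]
  have := hu.1
  positivity

lemma norm_eulerMaclaurinTerm_le {q : ℝ → ℝ} {B : ℝ} (hB : ∀ u ∈ Icc (0 : ℝ) 1, |q u| ≤ B)
    (n : ℕ) {s : ℂ} (hs : 0 ≤ s.re) :
    ‖eulerMaclaurinTerm q n s‖ ≤ B * (n + 1 : ℝ) ^ (-s.re) := by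
  have := intervalIntegral.norm_integral_le_of_norm_le_const (a := (0 : ℝ)) (b := 1)
    (f := fun u : ℝ => (q u : ℂ) * ((n + 1 + u : ℝ) : ℂ) ^ (-s))
    (C := B * (n + 1 : ℝ) ^ (-s.re)) ?_
  · simpa [eulerMaclaurinTerm] using this
  · intro u hu
    rw [uIoc_of_le zero_le_one] at hu
    rw [norm_mul, Complex.norm_real, Real.norm_eq_abs]
    have h0 := hB u ⟨hu.1.le, hu.2⟩
    exact mul_le_mul h0 (norm_natCast_add_cpow_le hu.1.le hs) (norm_nonneg _)
      ((abs_nonneg _).trans h0)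

lemma differentiable_eulerMaclaurinTerm {q : ℝ → ℝ} (hq : Continuous q) (n : ℕ) :
    Differentiable ℂ (eulerMaclaurinTerm q n) := by
  intro s₀
  have hpos : ∀ u ∈ Icc (0 : ℝ) 1, (0 : ℝ) < n + 1 + u := fun u hu => by
    have := hu.1; positivity
  have hcont : ContinuousOn (fun p : ℂ × ℝ => (q p.2 : ℂ) *
      (((n + 1 + p.2 : ℝ) : ℂ) ^ (-p.1) * Complex.log ((n + 1 + p.2 : ℝ) : ℂ) * (-1)))
      (Metric.closedBall s₀ 1 ×ˢ Icc (0 : ℝ) 1) := by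
    refine ContinuousOn.mul (by fun_prop) (ContinuousOn.mul (ContinuousOn.mul ?_ ?_) (by fun_prop))
    · refine ContinuousOn.cpow (by fun_prop) (by fun_prop) fun p hp => ?_
      left
      simpa only [Complex.ofReal_re] using hpos _ hp.2
    · refine ContinuousOn.clog (by fun_prop) fun p hp => ?_
      left
      simpa only [Complex.ofReal_re] using hpos _ hp.2
  obtain ⟨C, hC⟩ := ((isCompact_closedBall s₀ 1).prod isCompact_Icc).exists_bound_of_continuousOn
    hcont
  have hcs : ∀ s : ℂ, ContinuousOn (fun u : ℝ => (q u : ℂ) * ((n + 1 + u : ℝ) : ℂ) ^ (-s))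
      (uIoc (0 : ℝ) 1) := fun s => by
    rw [uIoc_of_le zero_le_one]
    exact (continuousOn_eulerMaclaurinTerm_integrand hq n s).mono Ioc_subset_Icc_self
  have key := intervalIntegral.hasDerivAt_integral_of_dominated_loc_of_deriv_le
    (μ := MeasureTheory.volume) (a := (0 : ℝ)) (b := 1)
    (F := fun s (u : ℝ) => (q u : ℂ) * ((n + 1 + u : ℝ) : ℂ) ^ (-s))
    (F' := fun s (u : ℝ) => (q u : ℂ) *
      (((n + 1 + u : ℝ) : ℂ) ^ (-s) * Complex.log ((n + 1 + u : ℝ) : ℂ) * (-1)))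
    (x₀ := s₀) (s := Metric.ball s₀ 1) (bound := fun _ => C)
    (Metric.ball_mem_nhds s₀ one_pos)
    (Eventually.of_forall fun s => (hcs s).aestronglyMeasurable measurableSet_uIoc)
    (by
      refine ContinuousOn.intervalIntegrable ?_
      rw [uIcc_of_le zero_le_one]
      exact continuousOn_eulerMaclaurinTerm_integrand hq n s₀)
    (by
      refine ContinuousOn.aestronglyMeasurable ?_ measurableSet_uIoc
      rw [uIoc_of_le zero_le_one]
      exact hcont.comp (f := fun u : ℝ => (s₀, u)) (by fun_prop) fun u hu =>
        ⟨Metric.mem_closedBall_self zero_le_one, Ioc_subset_Icc_self hu⟩)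
    (Eventually.of_forall fun u hu s hs => by
      rw [uIoc_of_le zero_le_one] at hu
      exact hC (s, u) ⟨Metric.ball_subset_closedBall hs, Ioc_subset_Icc_self hu⟩)
    (by simp)
    (Eventually.of_forall fun u hu s hs => by
      rw [uIoc_of_le zero_le_one] at hu
      refine HasDerivAt.const_mul _ ?_
      refine HasDerivAt.const_cpow (hasDerivAt_neg s) (Or.inl ?_)
      exact_mod_cast (hpos u (Ioc_subset_Icc_self hu)).ne')
  exact key.2.differentiableAt

/-- Integration by parts on one unit interval. The two boundary values stay separate because the
kernel 1, whose primitives have different end values, is needed as well as mean-zero kernels. -/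
lemma eulerMaclaurinTerm_eq_boundary {q Q : ℝ → ℝ} (hq : Continuous q)
    (hQ : ∀ u, HasDerivAt Q (q u) u) (n : ℕ) (s : ℂ) :
    eulerMaclaurinTerm q n s = Q 1 * ((n + 1 : ℕ) + 1 : ℂ) ^ (-s) - Q 0 * (n + 1 : ℂ) ^ (-s) +
      s * eulerMaclaurinTerm Q n (s + 1) := by
  have hQc : Continuous Q := continuous_iff_continuousAt.2 fun u => (hQ u).continuousAt
  have hv : ∀ u ∈ uIcc (0 : ℝ) 1, HasDerivAt (fun u : ℝ => ((n + 1 + u : ℝ) : ℂ) ^ (-s))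
      (-s * ((n + 1 + u : ℝ) : ℂ) ^ (-(s + 1))) u := by
    intro u hu
    rw [uIcc_of_le zero_le_one] at hu
    have h1 : (0 : ℝ) < n + 1 + u := by have := hu.1; positivity
    have h2 : HasDerivAt (fun z : ℂ => (n + 1 + z : ℂ)) 1 (u : ℂ) :=
      (hasDerivAt_id _).const_add _
    have h3 := (HasDerivAt.cpow_const (c := -s) h2 (Or.inl (by
      simpa using h1))).comp_ofReal
    convert h3 using 1
    · ext; push_cast; rfl
    · push_cast
      rw [neg_add']; ring
  have hint : ∀ g : ℝ → ℂ, ContinuousOn g (Icc 0 1) →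
      IntervalIntegrable g MeasureTheory.volume 0 1 := fun g hg =>
    ContinuousOn.intervalIntegrable (by rwa [uIcc_of_le zero_le_one])
  have key := intervalIntegral.integral_deriv_mul_eq_sub (a := (0 : ℝ)) (b := 1)
    (u := fun u : ℝ => (Q u : ℂ)) (u' := fun u => (q u : ℂ))
    (v := fun u : ℝ => ((n + 1 + u : ℝ) : ℂ) ^ (-s))
    (v' := fun u : ℝ => -s * ((n + 1 + u : ℝ) : ℂ) ^ (-(s + 1)))
    (fun u _ => (hQ u).ofReal_comp) hv ((hint _ (by fun_prop))) (hint _ (by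
      have := continuousOn_eulerMaclaurinTerm_integrand (q := fun _ => 1) (by fun_prop) n (s + 1)
      exact ((continuousOn_const (c := -s)).mul this).congr fun u _ => by simp))
  rw [intervalIntegral.integral_add (hint _ (continuousOn_eulerMaclaurinTerm_integrand hq n s))
    (hint _ ((continuousOn_eulerMaclaurinTerm_integrand hQc n (s + 1)).const_smul (-s) |>.congr
      fun u _ => by simp only [Pi.smul_apply, smul_eq_mul]; ring))] at key
  have h2 : ∫ u in (0 : ℝ)..1, (Q u : ℂ) * (-s * ((n + 1 + u : ℝ) : ℂ) ^ (-(s + 1))) =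
      -s * eulerMaclaurinTerm Q n (s + 1) := by
    rw [eulerMaclaurinTerm, ← intervalIntegral.integral_const_mul]
    congr 1; ext u; ring
  have key2 : eulerMaclaurinTerm q n s + -s * eulerMaclaurinTerm Q n (s + 1) =
      Q 1 * ((n + 1 + 1 : ℝ) : ℂ) ^ (-s) - Q 0 * ((n + 1 + 0 : ℝ) : ℂ) ^ (-s) := by
    rw [← h2]; exact key
  rw [eq_sub_of_add_eq key2]
  push_cast
  simp only [add_zero]
  ring

lemma eulerMaclaurinTerm_eq {q Q : ℝ → ℝ} (hq : Continuous q) (hQ : ∀ u, HasDerivAt Q (q u) u)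
    (hQ01 : Q 1 = Q 0) (n : ℕ) (s : ℂ) :
    eulerMaclaurinTerm q n s = Q 0 * (((n + 1 : ℕ) + 1 : ℂ) ^ (-s) - (n + 1 : ℂ) ^ (-s)) +
      s * eulerMaclaurinTerm Q n (s + 1) := by
  rw [eulerMaclaurinTerm_eq_boundary hq hQ, hQ01]
  ring

lemma summable_natCast_add_one_rpow_neg {a : ℝ} (ha : 1 < a) :
    Summable fun n : ℕ => (n + 1 : ℝ) ^ (-a) := by
  have := (summable_nat_add_iff 1).2 (Real.summable_nat_rpow.2 (show -a < -1 by linarith))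
  simpa using this

lemma tendsto_natCast_add_one_cpow_neg {s : ℂ} (hs : 0 < s.re) :
    Tendsto (fun n : ℕ => (n + 1 : ℂ) ^ (-s)) atTop (𝓝 0) := by
  rw [tendsto_zero_iff_norm_tendsto_zero]
  have h : ∀ n : ℕ, ‖(n + 1 : ℂ) ^ (-s)‖ = ((n + 1 : ℕ) : ℝ) ^ (-s.re) := fun n => by
    have := Complex.norm_cpow_eq_rpow_re_of_pos (x := ((n + 1 : ℕ) : ℝ)) (by positivity) (-s)
    simpa using this
  simp_rw [h]
  exact ((tendsto_rpow_neg_atTop hs).comp tendsto_natCast_atTop_atTop).comp (tendsto_add_atTop_nat 1)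

lemma hasSum_natCast_cpow_sub {s : ℂ} (hs : 0 < s.re)
    (hsum : Summable fun n : ℕ => (((n + 1 : ℕ) + 1 : ℂ) ^ (-s) - (n + 1 : ℂ) ^ (-s))) :
    HasSum (fun n : ℕ => (((n + 1 : ℕ) + 1 : ℂ) ^ (-s) - (n + 1 : ℂ) ^ (-s))) (-1) := by
  rw [hsum.hasSum_iff_tendsto_nat]
  have h : ∀ N : ℕ, ∑ n ∈ Finset.range N, (((n + 1 : ℕ) + 1 : ℂ) ^ (-s) - (n + 1 : ℂ) ^ (-s)) =
      (N + 1 : ℂ) ^ (-s) - 1 := fun N => by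
    rw [Finset.sum_range_sub (fun n : ℕ => (n + 1 : ℂ) ^ (-s))]
    simp
  simp_rw [h]
  simpa using (tendsto_natCast_add_one_cpow_neg hs).sub_const 1

lemma summable_natCast_cpow {s : ℂ} (hs : 1 < s.re) :
    Summable fun n : ℕ => (n + 1 : ℂ) ^ (-s) := by
  refine Summable.of_norm_bounded (summable_natCast_add_one_rpow_neg hs) fun n => ?_
  have := Complex.norm_cpow_eq_rpow_re_of_pos (x := ((n + 1 : ℕ) : ℝ)) (by positivity) (-s)
  simpa using this.le

lemma summable_natCast_cpow_sub {s : ℂ} (hs : 1 < s.re) :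
    Summable fun n : ℕ => (((n + 1 : ℕ) + 1 : ℂ) ^ (-s) - (n + 1 : ℂ) ^ (-s)) :=
  ((summable_nat_add_iff 1).2 (summable_natCast_cpow hs)).sub (summable_natCast_cpow hs)

lemma exists_bound_Icc {q : ℝ → ℝ} (hq : Continuous q) : ∃ B, ∀ u ∈ Icc (0 : ℝ) 1, |q u| ≤ B :=
  isCompact_Icc.exists_bound_of_continuousOn hq.continuousOn

lemma summable_eulerMaclaurinTerm {q : ℝ → ℝ} (hq : Continuous q) {s : ℂ} (hs : 1 < s.re) :
    Summable fun n => eulerMaclaurinTerm q n s := by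
  obtain ⟨B, hB⟩ := exists_bound_Icc hq
  exact Summable.of_norm_bounded ((summable_natCast_add_one_rpow_neg hs).mul_left B)
    fun n => norm_eulerMaclaurinTerm_le hB n (by linarith)

/-- The function `∑ₙ eulerMaclaurinTerm q n s`, for `q` of mean zero, continues analytically to the
left with polynomial growth. -/
lemma exists_continuation_eulerMaclaurinTerm (R : ℕ) : ∀ q : ℝ → ℝ, Continuous q →
    (∫ u in (0 : ℝ)..1, q u) = 0 → ∃ G : ℂ → ℂ, DifferentiableOn ℂ G {s | 1 - R < s.re} ∧
      (∃ C, ∀ s : ℂ, 3 / 2 - R ≤ s.re → ‖G s‖ ≤ C * (1 + ‖s‖) ^ R) ∧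
      ∀ s : ℂ, 1 < s.re → HasSum (fun n => eulerMaclaurinTerm q n s) (G s) := by
  induction R with
  | zero =>
    intro q hq _
    obtain ⟨B, hB⟩ := exists_bound_Icc hq
    have hB0 : 0 ≤ B := (abs_nonneg _).trans (hB 0 (by simp))
    have hle : ∀ a : ℝ, 1 < a → ∀ (n : ℕ) (s : ℂ), a ≤ s.re →
        ‖eulerMaclaurinTerm q n s‖ ≤ B * (n + 1 : ℝ) ^ (-a) := fun a ha n s hs => by
      refine (norm_eulerMaclaurinTerm_le hB n (by linarith)).trans ?_
      gcongr
      linarith [n.cast_nonneg (α := ℝ)]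
    refine ⟨fun s => ∑' n, eulerMaclaurinTerm q n s, ?_, ⟨∑' n : ℕ, B * (n + 1 : ℝ) ^ (-(3 / 2 : ℝ)), ?_⟩,
      fun s hs => (summable_eulerMaclaurinTerm hq hs).hasSum⟩
    · intro s hs
      simp only [Nat.cast_zero, sub_zero, mem_ofPred_eq] at hs
      obtain ⟨a, ha1, ha2⟩ := exists_between hs
      have hopen : IsOpen {s : ℂ | a < s.re} := isOpen_lt continuous_const Complex.continuous_re
      refine ((Complex.differentiableOn_tsum_of_summable_norm
        ((summable_natCast_add_one_rpow_neg ha1).mul_left B)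
        (fun n => (differentiable_eulerMaclaurinTerm hq n).differentiableOn) hopen
        fun n w hw => hle a ha1 n w (le_of_lt hw)).differentiableAt
        (hopen.mem_nhds ha2)).differentiableWithinAt
    · intro s hs
      simp only [Nat.cast_zero, sub_zero, pow_zero, mul_one] at hs ⊢
      exact tsum_of_norm_bounded
        ((summable_natCast_add_one_rpow_neg (by norm_num)).mul_left B).hasSum
        fun n => hle _ (by norm_num) n s hs
  | succ R ih =>
    intro q hq hq0
    -- Mean zero of `q` makes any primitive take equal values at 0 and 1, so the boundary terms
    -- telescope over n. Subtracting its average gives a primitive of mean zero, to which the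
    -- induction hypothesis applies.
    obtain ⟨Q, hQ, hQ01, hQ0⟩ : ∃ Q : ℝ → ℝ, (∀ u, HasDerivAt Q (q u) u) ∧ Q 1 = Q 0 ∧
        (∫ u in (0 : ℝ)..1, Q u) = 0 := by
      have hP : ∀ u, HasDerivAt (fun x => ∫ v in (0 : ℝ)..x, q v) (q u) u := fun u =>
        hq.integral_hasStrictDerivAt 0 u |>.hasDerivAt
      have hPc : Continuous (fun x => ∫ v in (0 : ℝ)..x, q v) :=
        continuous_iff_continuousAt.2 fun u => (hP u).continuousAt
      refine ⟨fun x => (∫ v in (0 : ℝ)..x, q v) - ∫ y in (0 : ℝ)..1, ∫ v in (0 : ℝ)..y, q v,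
        fun u => (hP u).sub_const _, by simp [hq0], ?_⟩
      rw [intervalIntegral.integral_sub (hPc.intervalIntegrable _ _) (by simp)]
      simp
    have hQc : Continuous Q := continuous_iff_continuousAt.2 fun u => (hQ u).continuousAt
    obtain ⟨G, hG1, ⟨C, hC⟩, hG3⟩ := ih Q hQc hQ0
    -- The telescoping boundary sum is -1. Each integration by parts gains one unit of half-plane
    -- and costs one factor s, hence the growth exponent.
    refine ⟨fun s => -Q 0 + s * G (s + 1), ?_, ⟨|Q 0| + |C| * 2 ^ R, ?_⟩, ?_⟩
    · refine DifferentiableOn.const_add _ (DifferentiableOn.mul differentiableOn_id ?_)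
      refine hG1.comp (f := fun s : ℂ => s + 1) (by fun_prop) fun s hs => ?_
      simp only [mem_ofPred_eq, Complex.add_re, Complex.one_re] at hs ⊢
      push_cast at hs; linarith
    · intro s hs
      have h1 := hC (s + 1) (by
        push_cast at hs
        simp only [Complex.add_re, Complex.one_re]; linarith)
      have h2 : 1 + ‖s + 1‖ ≤ 2 * (1 + ‖s‖) := by
        have := norm_add_le s 1
        simp only [norm_one] at this
        linarith [norm_nonneg s]
      have h3 : ‖G (s + 1)‖ ≤ |C| * 2 ^ R * (1 + ‖s‖) ^ R := by
        refine h1.trans ?_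
        rw [mul_assoc, ← mul_pow]
        refine mul_le_mul (le_abs_self C) ?_ (by positivity) (abs_nonneg C)
        gcongr
      have h4 : (1 : ℝ) ≤ (1 + ‖s‖) ^ (R + 1) := one_le_pow₀ (by linarith [norm_nonneg s])
      calc ‖-(Q 0 : ℂ) + s * G (s + 1)‖ ≤ |Q 0| + ‖s‖ * ‖G (s + 1)‖ := by
            refine (norm_add_le _ _).trans ?_
            rw [norm_neg, norm_mul, Complex.norm_real, Real.norm_eq_abs]
        _ ≤ |Q 0| * (1 + ‖s‖) ^ (R + 1) + (1 + ‖s‖) * (|C| * 2 ^ R * (1 + ‖s‖) ^ R) := by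
            gcongr
            · exact le_mul_of_one_le_right (abs_nonneg _) h4
            · linarith
        _ = _ := by ring
    · intro s hs
      have h1 := (hG3 (s + 1) (by simp only [Complex.add_re, Complex.one_re]; linarith)).mul_left s
      have h2 := ((hasSum_natCast_cpow_sub (s := s) (by linarith) (summable_natCast_cpow_sub hs)).mul_left (Q 0 : ℂ)).add h1
      simpa only [eulerMaclaurinTerm_eq hq hQ hQ01, mul_neg, mul_one] using h2

/-- Euler–Maclaurin in the half-plane of convergence. -/
lemma riemannZeta_eq_sub_tsum_eulerMaclaurinTerm {s : ℂ} (hs : 1 < s.re) {G : ℂ}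
    (hG : HasSum (fun n => eulerMaclaurinTerm (fun u => u - 1 / 2) n (s + 1)) G) :
    riemannZeta₀ s = 1 / 2 - s * G := by
  have hs0 : s - 1 ≠ 0 := fun h => by
    rw [sub_eq_zero.1 h] at hs; simp at hs
  have h1 : ∀ n : ℕ, (s - 1) * eulerMaclaurinTerm (fun _ => 1) n s =
      -(((n + 1 : ℕ) + 1 : ℂ) ^ (-(s - 1)) - (n + 1 : ℂ) ^ (-(s - 1))) := fun n => by
    -- Zero kernel with primitive 1, at exponent s - 1: this is the fundamental theorem of calculus
    -- for x^{-s} on one interval.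
    have := eulerMaclaurinTerm_eq_boundary (q := fun _ => 0) (Q := fun _ => 1) (by fun_prop)
      (fun u => hasDerivAt_const u 1) n (s - 1)
    rw [sub_add_cancel] at this
    have h0 : eulerMaclaurinTerm (fun _ => 0) n (s - 1) = 0 := by simp [eulerMaclaurinTerm]
    rw [h0] at this
    push_cast at this ⊢
    linear_combination -this
  have hsum1 := summable_eulerMaclaurinTerm (q := fun _ => 1) (by fun_prop) hs
  have h2 : HasSum (fun n => eulerMaclaurinTerm (fun _ => 1) n s) (s - 1)⁻¹ := by
    have h3 : HasSum (fun n => (s - 1) * eulerMaclaurinTerm (fun _ => 1) n s) (- -1) := by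
      simp_rw [h1]
      refine (hasSum_natCast_cpow_sub (by simpa using hs) ?_).neg
      simpa [h1] using (hsum1.mul_left (s - 1)).neg
    have := h3.mul_left (s - 1)⁻¹
    simpa [← mul_assoc, inv_mul_cancel₀ hs0] using this
  have hζ : HasSum (fun n : ℕ => (n + 1 : ℂ) ^ (-s)) (riemannZeta s) := by
    rw [zeta_eq_tsum_one_div_nat_add_one_cpow hs]
    simpa [Complex.cpow_neg] using (summable_natCast_cpow hs).hasSum
  have hζ' : HasSum (fun n : ℕ => ((n + 1 : ℕ) + 1 : ℂ) ^ (-s)) (riemannZeta s - 1) := by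
    have := (hasSum_nat_add_iff' 1).2 hζ
    simpa using this
  have h4 := ((hζ'.mul_left (1 / 2)).add (hζ.mul_left (1 / 2))).add (hG.mul_left s)
  have h5 : (s - 1)⁻¹ = 1 / 2 * (riemannZeta s - 1) + 1 / 2 * riemannZeta s + s * G := by
    -- The primitive u - 1/2 of 1 has end values ±1/2, which gives the trapezoidal rule with
    -- remainder.
    have h6 : ∀ n : ℕ, eulerMaclaurinTerm (fun _ => 1) n s =
        1 / 2 * ((n + 1 : ℕ) + 1 : ℂ) ^ (-s) + 1 / 2 * (n + 1 : ℂ) ^ (-s) +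
          s * eulerMaclaurinTerm (fun u => u - 1 / 2) n (s + 1) := fun n => by
      rw [eulerMaclaurinTerm_eq_boundary (q := fun _ => 1) (Q := fun u => u - 1 / 2)
        (by fun_prop) (fun u => (hasDerivAt_id u).sub_const _) n s]
      push_cast
      ring
    refine h2.unique ?_
    simp_rw [h6]
    exact h4
  rw [riemannZeta_eq_inv_sub_add (sub_ne_zero.1 hs0)] at h5
  linear_combination -h5

/-- `riemannZeta₀` has polynomial growth in every right half-plane. -/
lemma exists_norm_riemannZeta₀_le (a : ℝ) :
    ∃ (C : ℝ) (B : ℕ), 0 ≤ C ∧ ∀ s : ℂ, a ≤ s.re → ‖riemannZeta₀ s‖ ≤ C * (1 + ‖s‖) ^ B := by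
  obtain ⟨R, hR⟩ := exists_nat_gt (1 - a)
  obtain ⟨G, hG1, ⟨C, hC⟩, hG3⟩ := exists_continuation_eulerMaclaurinTerm (R + 1)
    (fun u => u - 1 / 2) (by fun_prop) (by
      rw [intervalIntegral.integral_sub (by simp) (by simp)]
      simp)
  have heq : EqOn riemannZeta₀ (fun s => 1 / 2 - s * G (s + 1)) {s | -R - 1 < s.re} := by
    have hopen : IsOpen {s : ℂ | -R - 1 < s.re} := isOpen_lt continuous_const Complex.continuous_re
    have hd : DifferentiableOn ℂ (fun s => 1 / 2 - s * G (s + 1)) {s | -R - 1 < s.re} := by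
      refine DifferentiableOn.const_sub (DifferentiableOn.mul differentiableOn_id ?_) _
      refine hG1.comp (f := fun s : ℂ => s + 1) (by fun_prop) fun s hs => ?_
      simp only [mem_ofPred_eq, Complex.add_re, Complex.one_re] at hs ⊢
      push_cast; linarith
    refine AnalyticOnNhd.eqOn_of_preconnected_of_eventuallyEq
      (differentiable_riemannZeta₀.differentiableOn.analyticOnNhd hopen)
      (hd.analyticOnNhd hopen) (convex_halfSpace_re_gt _).isPreconnected (z₀ := 2) ?_ ?_
    · simp only [mem_ofPred_eq, Complex.re_ofNat]
      linarith [R.cast_nonneg (α := ℝ)]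
    · filter_upwards [(isOpen_lt continuous_const Complex.continuous_re).mem_nhds
        (show (1 : ℝ) < (2 : ℂ).re by norm_num)] with s hs
      have hs : 1 < s.re := hs
      exact riemannZeta_eq_sub_tsum_eulerMaclaurinTerm hs
        (hG3 _ (by simp only [Complex.add_re, Complex.one_re]; linarith))
  refine ⟨1 + |C| * 2 ^ (R + 1), R + 2, by positivity, fun s hs => ?_⟩
  have hs' : -R - 1 < s.re := by linarith
  rw [heq hs']
  have h1 := hC (s + 1) (by simp only [Complex.add_re, Complex.one_re]; push_cast; linarith)
  have h2 : 1 + ‖s + 1‖ ≤ 2 * (1 + ‖s‖) := by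
    have := norm_add_le s 1
    simp only [norm_one] at this
    linarith [norm_nonneg s]
  have h3 : ‖G (s + 1)‖ ≤ |C| * 2 ^ (R + 1) * (1 + ‖s‖) ^ (R + 1) := by
    refine h1.trans ?_
    rw [mul_assoc, ← mul_pow]
    refine mul_le_mul (le_abs_self C) ?_ (by positivity) (abs_nonneg C)
    gcongr
  have h4 : (1 : ℝ) ≤ (1 + ‖s‖) ^ (R + 2) := one_le_pow₀ (by linarith [norm_nonneg s])
  calc ‖1 / 2 - s * G (s + 1)‖ ≤ 1 / 2 + ‖s‖ * ‖G (s + 1)‖ := by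
        refine (norm_sub_le _ _).trans ?_
        rw [norm_mul]; norm_num
    _ ≤ (1 + ‖s‖) ^ (R + 2) + (1 + ‖s‖) * (|C| * 2 ^ (R + 1) * (1 + ‖s‖) ^ (R + 1)) := by
        gcongr
        · linarith
        · linarith
    _ = _ := by ring

/-! ### Derivatives of zeta: polar and entire part. -/

lemma differentiable_iteratedDeriv_riemannZeta₀ (ℓ : ℕ) :
    Differentiable ℂ (iteratedDeriv ℓ riemannZeta₀) :=
  differentiable_riemannZeta₀.contDiff.differentiable_iteratedDeriv ℓ
    (WithTop.coe_lt_top (ℓ : ℕ∞))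

lemma iteratedDeriv_riemannZeta_eq (ℓ : ℕ) {s : ℂ} (hs : s ≠ 1) :
    iteratedDeriv ℓ riemannZeta s =
      (-1) ^ ℓ * ℓ.factorial / (s - 1) ^ (ℓ + 1) + iteratedDeriv ℓ riemannZeta₀ s := by
  have h1 : riemannZeta =ᶠ[𝓝 s] (fun z => (z - 1)⁻¹) + riemannZeta₀ := by
    filter_upwards [compl_singleton_mem_nhds hs] with z hz
    exact riemannZeta_eq_inv_sub_add hz
  have h2 : ContDiffAt ℂ ℓ (fun z : ℂ => (z - 1)⁻¹) s :=
    (contDiffAt_id.sub contDiffAt_const).inv (sub_ne_zero.2 hs)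
  rw [h1.iteratedDeriv_eq ℓ, iteratedDeriv_add h2
    (differentiable_riemannZeta₀.contDiff.contDiffAt)]
  congr 1
  have h3 := congrFun (iteratedDeriv_comp_sub_const ℓ (fun z : ℂ => z⁻¹) 1) s
  rw [h3, iteratedDeriv_eq_iterate]
  have h4 := iter_deriv_inv ℓ (s - 1)
  rw [show (fun z : ℂ => z⁻¹) = Inv.inv from rfl, h4, div_eq_mul_inv,
    show (-1 - (ℓ : ℤ)) = -((ℓ + 1 : ℕ) : ℤ) by push_cast; ring, zpow_neg, zpow_natCast]

/-- Cauchy's estimate on the unit circle about s; the circle reaches one unit to the left, so the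
growth bound is taken from a - 1. -/
lemma exists_norm_iteratedDeriv_riemannZeta₀_le (ℓ : ℕ) (a : ℝ) : ∃ (C : ℝ) (B : ℕ), 0 ≤ C ∧
    ∀ s : ℂ, a ≤ s.re → ‖iteratedDeriv ℓ riemannZeta₀ s‖ ≤ C * (1 + ‖s‖) ^ B := by
  obtain ⟨C, B, hC0, hC⟩ := exists_norm_riemannZeta₀_le (a - 1)
  refine ⟨ℓ.factorial * (C * 2 ^ B), B, by positivity, fun s hs => ?_⟩
  have := Complex.norm_iteratedDeriv_le_of_forall_mem_sphere_norm_le (c := s) (R := 1)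
    (C := C * (2 * (1 + ‖s‖)) ^ B) ℓ one_pos differentiable_riemannZeta₀.diffContOnCl ?_
  · refine this.trans_eq ?_
    rw [mul_pow]; simp; ring
  · intro z hz
    rw [mem_sphere_iff_norm] at hz
    have h1 : z.re ≥ s.re - 1 := by
      have := Complex.abs_re_le_norm (z - s)
      rw [hz, abs_le] at this
      simp only [Complex.sub_re] at this
      linarith
    refine (hC z (by linarith)).trans ?_
    have h2 : ‖z‖ ≤ 1 + ‖s‖ := by
      have := norm_add_le (z - s) s
      rwa [sub_add_cancel, hz] at this
    gcongr
    linarith [norm_nonneg s]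

/-! ### Non-stationary phase. -/

/-- The Mellin integral over `[y₀, y₁]` of `b` against `exp (-i T y)` and a power of the reciprocal
phase derivative `s - i T y`. -/
noncomputable def oscIntegral (y₀ y₁ : ℝ) (s : ℂ) (T : ℝ) (b : ℝ → ℂ) (j : ℕ) : ℂ :=
  ∫ y in y₀..y₁, b y * (s - T * y * Complex.I)⁻¹ ^ j *
    ((y : ℂ) ^ (s - 1) * Complex.exp (-(T * y * Complex.I)))

section

variable {y₀ y₁ T : ℝ} {s : ℂ}

lemma continuousOn_oscIntegral_integrand (h0 : 0 < y₀) {b : ℝ → ℂ} (hb : Continuous b)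
    (hq : ∀ y ∈ Icc y₀ y₁, s - T * y * Complex.I ≠ 0) (j : ℕ) (w : ℂ) :
    ContinuousOn (fun y : ℝ => b y * (s - T * y * Complex.I)⁻¹ ^ j *
      ((y : ℂ) ^ w * Complex.exp (-(T * y * Complex.I)))) (Icc y₀ y₁) := by
  refine ContinuousOn.mul (ContinuousOn.mul hb.continuousOn
    ((ContinuousOn.inv₀ (by fun_prop) hq).pow j)) (ContinuousOn.mul ?_ (by fun_prop))
  refine ContinuousOn.cpow_const (by fun_prop) fun y hy => Or.inl ?_
  simpa using h0.trans_le hy.1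

/-- Since (y^s e^{-iTy})' = (s - iTy) y^{s-1} e^{-iTy}, dividing by the phase derivative s - iTy
allows integration by parts. The derivative falls on the amplitude, giving j + 1, or on the
reciprocal power, giving j + 2 with a factor T. -/
lemma oscIntegral_by_parts (h0 : 0 < y₀) (h01 : y₀ ≤ y₁) {b : ℝ → ℂ} (hb : ContDiff ℝ 1 b)
    (hb0 : b y₀ = 0) (hb1 : b y₁ = 0) (hq : ∀ y ∈ Icc y₀ y₁, s - T * y * Complex.I ≠ 0) (j : ℕ) :
    oscIntegral y₀ y₁ s T b j = -oscIntegral y₀ y₁ s T (fun y => y * deriv b y) (j + 1) -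
      (j + 1) * (T * Complex.I) * oscIntegral y₀ y₁ s T (fun y => y * b y) (j + 2) := by
  have hcd : Continuous (deriv b) := hb.continuous_deriv le_rfl
  have hint : ∀ g : ℝ → ℂ, ContinuousOn g (Icc y₀ y₁) →
      IntervalIntegrable g MeasureTheory.volume y₀ y₁ := fun g hg =>
    ContinuousOn.intervalIntegrable (by rwa [uIcc_of_le h01])
  have hu : ∀ y ∈ uIcc y₀ y₁, HasDerivAt (fun y : ℝ => b y * (s - T * y * Complex.I)⁻¹ ^ (j + 1))
      (deriv b y * (s - T * y * Complex.I)⁻¹ ^ (j + 1) +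
        b y * ((j + 1) * (T * Complex.I) * (s - T * y * Complex.I)⁻¹ ^ (j + 2))) y := by
    intro y hy
    rw [uIcc_of_le h01] at hy
    have h1 : HasDerivAt (fun y : ℝ => s - T * y * Complex.I) (-(T * Complex.I)) y := by
      have := ((Complex.ofRealCLM.hasDerivAt (x := y)).const_mul (T : ℂ)).mul_const Complex.I
      simpa using this.const_sub s
    refine ((hb.differentiable one_ne_zero).differentiableAt.hasDerivAt).mul ?_
    have h2 := (h1.inv (hq y hy)).pow (j + 1)
    refine h2.congr_deriv ?_
    simp only [Pi.inv_apply, Nat.cast_add, Nat.cast_one, add_tsub_cancel_right, neg_neg,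
      div_eq_mul_inv, ← inv_pow]
    generalize (s - T * y * Complex.I)⁻¹ = q
    ring
  have hv : ∀ y ∈ uIcc y₀ y₁,
      HasDerivAt (fun y : ℝ => (y : ℂ) ^ s * Complex.exp (-(T * y * Complex.I)))
      ((s - T * y * Complex.I) * ((y : ℂ) ^ (s - 1) * Complex.exp (-(T * y * Complex.I)))) y := by
    intro y hy
    rw [uIcc_of_le h01] at hy
    have hy0 : 0 < y := h0.trans_le hy.1
    have hyc : (y : ℂ) ≠ 0 := by exact_mod_cast hy0.ne'
    have h1 : HasDerivAt (fun z : ℂ => z ^ s) (s * (y : ℂ) ^ (s - 1)) (y : ℂ) := by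
      simpa using (hasDerivAt_id (y : ℂ)).cpow_const (c := s) (Or.inl (by simpa using hy0))
    have h2 : HasDerivAt (fun z : ℂ => Complex.exp (-(T * z * Complex.I)))
        (Complex.exp (-(T * (y : ℂ) * Complex.I)) * -(T * Complex.I)) (y : ℂ) := by
      refine HasDerivAt.cexp ?_
      simpa using (((hasDerivAt_id (y : ℂ)).const_mul (T : ℂ)).mul_const Complex.I).fun_neg
    refine (h1.mul h2).comp_ofReal.congr_deriv ?_
    have h3 : (y : ℂ) ^ s = y * (y : ℂ) ^ (s - 1) := by
      rw [Complex.cpow_sub _ _ hyc, Complex.cpow_one, mul_div_cancel₀ _ hyc]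
    rw [h3]
    ring
  have c1 := continuousOn_oscIntegral_integrand (T := T) (s := s) (y₁ := y₁) h0
    (b := fun y => y * deriv b y) (by fun_prop) hq (j + 1) (s - 1)
  have c2 := continuousOn_oscIntegral_integrand (T := T) (s := s) (y₁ := y₁) h0
    (b := fun y => y * b y) (by have := hb.continuous; fun_prop) hq (j + 2) (s - 1)
  have key := intervalIntegral.integral_mul_deriv_eq_deriv_mul hu hv
    (hint _ (by
      refine ContinuousOn.add (hcd.continuousOn.mul ((ContinuousOn.inv₀ (by fun_prop) hq).pow _))
        (hb.continuous.continuousOn.mul (continuousOn_const.mul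
          ((ContinuousOn.inv₀ (by fun_prop) hq).pow _)))))
    (hint _ (by
      refine ContinuousOn.mul (by fun_prop) (ContinuousOn.mul ?_ (by fun_prop))
      refine ContinuousOn.cpow_const (by fun_prop) fun y hy => Or.inl ?_
      simpa using h0.trans_le hy.1))
  have e1 : ∫ y in y₀..y₁, b y * (s - T * y * Complex.I)⁻¹ ^ (j + 1) *
      ((s - T * y * Complex.I) * ((y : ℂ) ^ (s - 1) * Complex.exp (-(T * y * Complex.I)))) =
      oscIntegral y₀ y₁ s T b j := by
    refine intervalIntegral.integral_congr fun y hy => ?_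
    rw [uIcc_of_le h01] at hy
    have := hq y hy
    simp only [pow_succ]
    field_simp
  have e2 : ∫ y in y₀..y₁, (deriv b y * (s - T * y * Complex.I)⁻¹ ^ (j + 1) +
        b y * ((j + 1) * (T * Complex.I) * (s - T * y * Complex.I)⁻¹ ^ (j + 2))) *
        ((y : ℂ) ^ s * Complex.exp (-(T * y * Complex.I))) =
      oscIntegral y₀ y₁ s T (fun y => y * deriv b y) (j + 1) +
      (j + 1) * (T * Complex.I) * oscIntegral y₀ y₁ s T (fun y => y * b y) (j + 2) := by
    rw [oscIntegral, oscIntegral, ← intervalIntegral.integral_const_mul,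
      ← intervalIntegral.integral_add (hint _ c1) ((hint _ c2).const_mul _)]
    refine intervalIntegral.integral_congr fun y hy => ?_
    rw [uIcc_of_le h01] at hy
    have hyc : (y : ℂ) ≠ 0 := by exact_mod_cast (h0.trans_le hy.1).ne'
    have h3 : (y : ℂ) ^ s = y * (y : ℂ) ^ (s - 1) := by
      rw [Complex.cpow_sub _ _ hyc, Complex.cpow_one, mul_div_cancel₀ _ hyc]
    simp only [h3]
    ring
  rw [e1, e2, hb0, hb1] at key
  rw [key]
  ring

lemma exists_rpow_le (h0 : 0 < y₀) (A B : ℝ) :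
    ∃ C, 0 ≤ C ∧ ∀ a ∈ Icc A B, ∀ y ∈ Icc y₀ y₁, y ^ a ≤ C := by
  obtain ⟨C, hC⟩ := (isCompact_Icc.prod isCompact_Icc).exists_bound_of_continuousOn
    (f := fun p : ℝ × ℝ => p.2 ^ p.1) (s := Icc A B ×ˢ Icc y₀ y₁)
    (ContinuousOn.rpow (by fun_prop) (by fun_prop) fun p hp => Or.inl (h0.trans_le hp.2.1).ne')
  exact ⟨|C|, abs_nonneg _, fun a ha y hy =>
    (le_abs_self _).trans ((hC (a, y) ⟨ha, hy⟩).trans (le_abs_self _))⟩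

/-- Non-stationary phase: arbitrary polynomial decay, uniformly in vertical strips. -/
lemma exists_norm_oscIntegral_le (h0 : 0 < y₀) (h01 : y₀ ≤ y₁) {κ : ℝ} (hκ : 0 < κ) (A B : ℝ)
    (N : ℕ) : ∀ b : ℝ → ℂ, ContDiff ℝ (⊤ : ℕ∞) b → tsupport b ⊆ Ioo y₀ y₁ → ∀ j : ℕ, ∃ C, 0 ≤ C ∧
      ∀ (s : ℂ) (T : ℝ), s.re ∈ Icc A B → 0 < T →
        (∀ y ∈ Icc y₀ y₁, κ * (|s.im| + T) ≤ |s.im - T * y|) →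
        ‖oscIntegral y₀ y₁ s T b j‖ * (|s.im| + T) ^ (j + N) ≤ C := by
  have hnorm : ∀ (s : ℂ) (T y : ℝ), |s.im - T * y| ≤ ‖s - T * y * Complex.I‖ := fun s T y => by
    have := Complex.abs_im_le_norm (s - T * y * Complex.I)
    simpa using this
  induction N with
  | zero =>
    intro b hb hbs j
    obtain ⟨M, hM⟩ := isCompact_Icc.exists_bound_of_continuousOn (s := Icc y₀ y₁)
      hb.continuous.continuousOn
    have hM0 : 0 ≤ M := (norm_nonneg _).trans (hM y₀ ⟨le_rfl, h01⟩)
    obtain ⟨D, hD0, hD⟩ := exists_rpow_le (y₀ := y₀) (y₁ := y₁) h0 (A - 1) (B - 1)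
    refine ⟨M * κ⁻¹ ^ j * D * |y₁ - y₀|, by positivity, fun s T hs hT hy => ?_⟩
    have hΛ : 0 < |s.im| + T := by positivity
    have h1 := intervalIntegral.norm_integral_le_of_norm_le_const (a := y₀) (b := y₁)
      (f := fun y : ℝ => b y * (s - T * y * Complex.I)⁻¹ ^ j *
        ((y : ℂ) ^ (s - 1) * Complex.exp (-(T * y * Complex.I))))
      (C := M * (κ * (|s.im| + T))⁻¹ ^ j * D) (fun y hy' => by
        rw [uIoc_of_le h01] at hy'
        have hyI := Ioc_subset_Icc_self hy'
        have hy0 : 0 < y := h0.trans hy'.1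
        rw [norm_mul, norm_mul, norm_mul, norm_pow, norm_inv, Complex.norm_cpow_eq_rpow_re_of_pos hy0,
          Complex.norm_exp]
        have e : (-(T * y * Complex.I : ℂ)).re = 0 := by simp
        rw [e, Real.exp_zero, mul_one]
        gcongr
        · exact hM y hyI
        · exact (hy y hyI).trans (hnorm s T y)
        · exact hD _ (by simpa using hs) y hyI)
    have h2 : ‖oscIntegral y₀ y₁ s T b j‖ ≤ M * (κ * (|s.im| + T))⁻¹ ^ j * D * |y₁ - y₀| := h1
    calc _ ≤ M * (κ * (|s.im| + T))⁻¹ ^ j * D * |y₁ - y₀| * (|s.im| + T) ^ j := by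
          rw [add_zero]; gcongr
      _ = M * κ⁻¹ ^ j * D * |y₁ - y₀| * ((|s.im| + T)⁻¹ * (|s.im| + T)) ^ j := by
          rw [mul_inv, mul_pow, mul_pow]; ring
      _ = _ := by rw [inv_mul_cancel₀ hΛ.ne', one_pow, mul_one]
  | succ N ih =>
    intro b hb hbs j
    have hid : ContDiff ℝ (⊤ : ℕ∞) (fun y : ℝ => (y : ℂ)) := Complex.ofRealCLM.contDiff
    obtain ⟨C₁, hC₁0, hC₁⟩ := ih (fun y => y * deriv b y)
      (hid.mul ((contDiff_infty_iff_deriv.1 hb).2))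
      ((tsupport_mul_subset_right).trans ((tsupport_deriv_subset (f := b)).trans hbs)) (j + 1)
    obtain ⟨C₂, hC₂0, hC₂⟩ := ih (fun y => y * b y) (hid.mul hb)
      ((tsupport_mul_subset_right).trans hbs) (j + 2)
    refine ⟨C₁ + (j + 1) * C₂, by positivity, fun s T hs hT hy => ?_⟩
    have hΛ : 0 < |s.im| + T := by positivity
    have hq : ∀ y ∈ Icc y₀ y₁, s - T * y * Complex.I ≠ 0 := fun y hy' => by
      rw [← norm_pos_iff]
      exact lt_of_lt_of_le (by positivity) ((hy y hy').trans (hnorm s T y))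
    have hz : ∀ y, y ∉ Ioo y₀ y₁ → b y = 0 := fun y hy' =>
      image_eq_zero_of_notMem_tsupport fun h => hy' (hbs h)
    rw [oscIntegral_by_parts h0 h01 (hb.of_le (by simp)) (hz _ (by simp)) (hz _ (by simp)) hq j]
    have k1 := hC₁ s T hs hT hy
    have k2 := hC₂ s T hs hT hy
    set J₁ := oscIntegral y₀ y₁ s T (fun y => y * deriv b y) (j + 1)
    set J₂ := oscIntegral y₀ y₁ s T (fun y => y * b y) (j + 2)
    -- The factor T ≤ |Im s| + T uses up one of the two extra powers carried by J₂, so both terms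
    -- gain exactly one power.
    have hn : ‖-J₁ - (j + 1) * (T * Complex.I) * J₂‖ ≤ ‖J₁‖ + (j + 1) * (|s.im| + T) * ‖J₂‖ := by
      refine (norm_sub_le _ _).trans ?_
      rw [norm_neg, norm_mul, norm_mul, norm_mul, Complex.norm_I, mul_one, Complex.norm_real,
        Real.norm_of_nonneg hT.le]
      have : ‖(j + 1 : ℂ)‖ = j + 1 := by exact_mod_cast Complex.norm_natCast (j + 1)
      rw [this]
      gcongr
      linarith [abs_nonneg s.im]
    calc _ ≤ (‖J₁‖ + (j + 1) * (|s.im| + T) * ‖J₂‖) * (|s.im| + T) ^ (j + (N + 1)) := by gcongr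
      _ = ‖J₁‖ * (|s.im| + T) ^ (j + 1 + N) +
          (j + 1) * (‖J₂‖ * (|s.im| + T) ^ (j + 2 + N)) := by ring
      _ ≤ _ := by gcongr

end

/-! ### The oscillating test function and its Mellin transform. -/

/-- The oscillating test function. -/
noncomputable def oscTest (b : ℝ → ℝ) (T y : ℝ) : ℂ := b y * Complex.exp (-(T * y * Complex.I))

lemma mellin_oscTest {y₀ y₁ : ℝ} (h0 : 0 < y₀) (h01 : y₀ ≤ y₁) {b : ℝ → ℝ}
    (hbs : tsupport b ⊆ Ioo y₀ y₁) (T : ℝ) (s : ℂ) :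
    mellin (oscTest b T) s = oscIntegral y₀ y₁ s T (fun y => b y) 0 := by
  rw [mellin, oscIntegral, intervalIntegral.integral_of_le h01]
  refine (MeasureTheory.setIntegral_eq_of_subset_of_forall_sdiff_eq_zero measurableSet_Ioi
    (fun y hy => h0.trans hy.1 : Ioc y₀ y₁ ⊆ Ioi 0) ?_).trans ?_
  rotate_left
  · refine MeasureTheory.setIntegral_congr_fun measurableSet_Ioc fun y _ => ?_
    simp only [oscTest, smul_eq_mul, pow_zero, mul_one]
    ring
  · intro y hy
    have : b y = 0 := image_eq_zero_of_notMem_tsupport fun h => hy.2 (Ioo_subset_Ioc_self (hbs h))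
    simp [oscTest, this]

/-- The stationary point y = t/T lies outside (w₀, 1) or at its ends, hence at positive distance
from [y₀, y₁]. The two terms of the minimum treat t > T and t < w₀T. -/
lemma le_abs_sub_of_notMem_window {w₀ y₀ y₁ : ℝ} (hw : 0 ≤ w₀) (hwy : w₀ < y₀) (hy1 : y₁ < 1)
    {t T : ℝ} (hT : 0 < T) (ht : t ∉ Icc (w₀ * T) T) {y : ℝ} (hy : y ∈ Icc y₀ y₁) :
    min ((1 - y₁) / 2) ((y₀ - w₀) / 2) * (|t| + T) ≤ |t - T * y| := by
  have hy1' : y < 1 := hy.2.trans_lt hy1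
  by_cases h : t < w₀ * T
  · have h1 : (y₀ - w₀) / 2 * (|t| + T) ≤ T * y - t := by
      have : T * y₀ ≤ T * y := by gcongr; exact hy.1
      rcases le_or_gt 0 t with h0 | h0
      · rw [abs_of_nonneg h0]
        have : w₀ * T ≤ 1 * T := by gcongr; linarith [hy.1]
        nlinarith [hy.1]
      · rw [abs_of_neg h0]
        nlinarith [hy.1]
    calc _ ≤ (y₀ - w₀) / 2 * (|t| + T) := by gcongr; exact min_le_right _ _
      _ ≤ T * y - t := h1
      _ ≤ _ := by rw [abs_sub_comm]; exact le_abs_self _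
  · have h2 : T < t := by
      by_contra h3
      exact ht ⟨not_lt.1 h, not_lt.1 h3⟩
    calc _ ≤ (1 - y₁) / 2 * (|t| + T) := by gcongr; exact min_le_left _ _
      _ ≤ t - T * y := by
        rw [abs_of_pos (hT.trans h2)]
        have : T * y ≤ T * y₁ := by gcongr; exact hy.2
        have : y₁ * T ≤ y₁ * t := by
          gcongr
          linarith [hy.1, hy.2]
        nlinarith
      _ ≤ _ := le_abs_self _

/-- Decay of the Mellin transform of the test function off the window `[w₀ T, T]`. -/
lemma exists_norm_mellin_oscTest_le {w₀ y₀ y₁ : ℝ} (hw : 0 ≤ w₀) (hwy : w₀ < y₀) (h01 : y₀ ≤ y₁)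
    (hy1 : y₁ < 1) {b : ℝ → ℝ} (hb : ContDiff ℝ (⊤ : ℕ∞) b) (hbs : tsupport b ⊆ Ioo y₀ y₁)
    (A B : ℝ) (N : ℕ) : ∃ C, 0 ≤ C ∧ ∀ (s : ℂ) (T : ℝ), s.re ∈ Icc A B → 0 < T →
      s.im ∉ Icc (w₀ * T) T → ‖mellin (oscTest b T) s‖ * (|s.im| + T) ^ N ≤ C := by
  have h0 : 0 < y₀ := hw.trans_lt hwy
  obtain ⟨C, hC0, hC⟩ := exists_norm_oscIntegral_le h0 h01
    (κ := min ((1 - y₁) / 2) ((y₀ - w₀) / 2)) (lt_min (by linarith) (by linarith)) A B N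
    (fun y => (b y : ℂ)) (Complex.ofRealCLM.contDiff.comp hb)
    ((tsupport_comp_subset Complex.ofReal_zero b).trans hbs) 0
  refine ⟨C, hC0, fun s T hs hT him => ?_⟩
  rw [mellin_oscTest h0 h01 hbs]
  have := hC s T hs hT fun y hy => le_abs_sub_of_notMem_window hw hwy hy1 hT him hy
  rwa [zero_add] at this

lemma exists_norm_mellin_oscTest_le_const {y₀ y₁ : ℝ} (h0 : 0 < y₀) (h01 : y₀ ≤ y₁)
    {b : ℝ → ℝ} (hb : Continuous b) (hbs : tsupport b ⊆ Ioo y₀ y₁) (A B : ℝ) :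
    ∃ C, 0 ≤ C ∧ ∀ (s : ℂ) (T : ℝ), s.re ∈ Icc A B → ‖mellin (oscTest b T) s‖ ≤ C := by
  obtain ⟨M, hM⟩ := isCompact_Icc.exists_bound_of_continuousOn (s := Icc y₀ y₁) hb.continuousOn
  have hM0 : 0 ≤ M := (norm_nonneg _).trans (hM y₀ ⟨le_rfl, h01⟩)
  obtain ⟨D, hD0, hD⟩ := exists_rpow_le (y₀ := y₀) (y₁ := y₁) h0 (A - 1) (B - 1)
  refine ⟨M * D * |y₁ - y₀|, by positivity, fun s T hs => ?_⟩
  rw [mellin_oscTest h0 h01 hbs]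
  refine intervalIntegral.norm_integral_le_of_norm_le_const fun y hy' => ?_
  rw [uIoc_of_le h01] at hy'
  have hyI := Ioc_subset_Icc_self hy'
  have hy0 : 0 < y := h0.trans hy'.1
  have e : (-(T * y * Complex.I : ℂ)).re = 0 := by simp
  rw [pow_zero, mul_one, norm_mul, norm_mul, Complex.norm_cpow_eq_rpow_re_of_pos hy0,
    Complex.norm_exp, e, Real.exp_zero, mul_one, Complex.norm_real]
  gcongr
  · exact hM y hyI
  · exact hD _ (by simpa using hs) y hyI

/-! ### Contour shifts and Plancherel for Mellin transforms. -/

/-- Shift of a vertical line of integration. -/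
lemma integral_vertical_eq_of_decay {G : ℂ → ℂ} (hG : Differentiable ℂ G) {a b C : ℝ} (hab : a ≤ b)
    (hC : ∀ s : ℂ, s.re ∈ Icc a b → ‖G s‖ * (1 + |s.im|) ^ 2 ≤ C) :
    ∫ t : ℝ, G (a + t * Complex.I) = ∫ t : ℝ, G (b + t * Complex.I) := by
  have hpos : ∀ t : ℝ, 0 < (1 + |t|) ^ 2 := fun t => by positivity
  have hb : ∀ s : ℂ, s.re ∈ Icc a b → ‖G s‖ ≤ C / (1 + |s.im|) ^ 2 := fun s hs =>
    (le_div_iff₀ (hpos _)).2 (hC s hs)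
  have hC0 : 0 ≤ C := by
    refine le_trans ?_ (hC a (by simpa using hab))
    positivity
  have hint : ∀ c ∈ Icc a b, MeasureTheory.Integrable fun t : ℝ => G (c + t * Complex.I) := by
    intro c hc
    refine MeasureTheory.Integrable.mono' (integrable_inv_one_add_sq.const_mul C) ?_ ?_
    · have := hG.continuous
      exact Continuous.aestronglyMeasurable (by fun_prop)
    · refine Eventually.of_forall fun t => ?_
      refine (hb _ (by simpa using hc)).trans ?_
      simp only [Complex.add_im, Complex.ofReal_im, Complex.mul_im, Complex.ofReal_re, Complex.I_im,
        mul_one, Complex.I_re, mul_zero, add_zero, zero_add]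
      rw [div_eq_mul_inv]
      gcongr
      nlinarith [abs_nonneg t, sq_abs t]
  have hlim : ∀ ε : ℝ, |ε| = 1 →
      Tendsto (fun R : ℝ => ∫ x in a..b, G (x + (ε * R : ℝ) * Complex.I)) atTop (𝓝 0) := by
    intro ε hε
    refine squeeze_zero_norm' (a := fun R : ℝ => C / R * |b - a|) ?_ ?_
    · filter_upwards [eventually_ge_atTop (1 : ℝ)] with R hR
      refine intervalIntegral.norm_integral_le_of_norm_le_const fun x hx => ?_
      rw [uIoc_of_le hab] at hx
      refine (hb _ (by simpa using Ioc_subset_Icc_self hx)).trans ?_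
      have : |((x : ℂ) + (ε * R : ℝ) * Complex.I).im| = R := by
        simp [abs_mul, hε, abs_of_nonneg (zero_le_one.trans hR)]
      rw [this]
      gcongr
      nlinarith
    · have := (tendsto_const_nhds (x := C)).div_atTop tendsto_id
      simpa using this.mul_const |b - a|
  have h1 := MeasureTheory.intervalIntegral_tendsto_integral (hint a ⟨le_rfl, hab⟩)
    tendsto_neg_atTop_atBot tendsto_id
  have h2 := MeasureTheory.intervalIntegral_tendsto_integral (hint b ⟨hab, le_rfl⟩)
    tendsto_neg_atTop_atBot tendsto_id
  have h3 : ∀ R : ℝ, Complex.I * (∫ t in (-R)..(id R), G (b + t * Complex.I)) -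
      Complex.I * (∫ t in (-R)..(id R), G (a + t * Complex.I)) =
      (∫ x in a..b, G (x + (1 * R : ℝ) * Complex.I)) -
        ∫ x in a..b, G (x + (-1 * R : ℝ) * Complex.I) := fun R => by
    have := Complex.integral_boundary_rect_eq_zero_of_differentiableOn G ⟨a, -R⟩ ⟨b, R⟩
      hG.differentiableOn
    simp only [smul_eq_mul] at this
    simp only [id, one_mul, neg_mul]
    linear_combination this
  have h4 := ((h2.const_mul Complex.I).sub (h1.const_mul Complex.I))
  simp_rw [h3] at h4
  have h5 := tendsto_nhds_unique h4 ((hlim 1 (by simp)).sub (hlim (-1) (by simp)))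
  rw [sub_zero, ← mul_sub] at h5
  have := (mul_eq_zero.1 h5).resolve_left Complex.I_ne_zero
  exact (sub_eq_zero.1 this).symm

section

variable {f : ℝ → ℂ} {a b : ℝ}

lemma isBigO_atTop_of_tsupport_subset (hs : tsupport f ⊆ Ioo a b) (g : ℝ → ℝ) : f =O[atTop] g := by
  refine EventuallyEq.trans_isBigO (f₂ := fun _ => (0 : ℂ)) ?_ (Asymptotics.isBigO_zero _ _)
  filter_upwards [eventually_ge_atTop b] with x hx
  exact image_eq_zero_of_notMem_tsupport fun h => absurd (hs h).2 (not_lt.2 hx)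

lemma isBigO_zero_of_tsupport_subset (ha : 0 < a) (hs : tsupport f ⊆ Ioo a b) (g : ℝ → ℝ) :
    f =O[𝓝[>] 0] g := by
  refine EventuallyEq.trans_isBigO (f₂ := fun _ => (0 : ℂ)) ?_ (Asymptotics.isBigO_zero _ _)
  filter_upwards [nhdsWithin_le_nhds (Iio_mem_nhds ha)] with x hx
  exact image_eq_zero_of_notMem_tsupport fun h => absurd (hs h).1 (not_lt.2 (le_of_lt hx))

lemma mellinConvergent_of_tsupport_subset (ha : 0 < a) (hf : Continuous f)
    (hs : tsupport f ⊆ Ioo a b) (s : ℂ) : MellinConvergent f s :=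
  mellinConvergent_of_isBigO_rpow (a := s.re + 1) (b := s.re - 1)
    (hf.locallyIntegrable.locallyIntegrableOn _) (isBigO_atTop_of_tsupport_subset hs _)
    (by linarith) (isBigO_zero_of_tsupport_subset ha hs _) (by linarith)

lemma differentiable_mellin_of_tsupport_subset (ha : 0 < a) (hf : Continuous f)
    (hs : tsupport f ⊆ Ioo a b) : Differentiable ℂ (mellin f) := fun s =>
  mellin_differentiableAt_of_isBigO_rpow (a := s.re + 1) (b := s.re - 1)
    (hf.locallyIntegrable.locallyIntegrableOn _) (isBigO_atTop_of_tsupport_subset hs _)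
    (by linarith) (isBigO_zero_of_tsupport_subset ha hs _) (by linarith)

open scoped FourierTransform in
/-- Plancherel for the Mellin transform of a test function on `(0, ∞)`. -/
lemma integral_norm_mellin_sq (ha : 0 < a) (hf : ContDiff ℝ (⊤ : ℕ∞) f)
    (hs : tsupport f ⊆ Ioo a b) (σ : ℝ) :
    ∫ t : ℝ, ‖mellin f (σ + t * Complex.I)‖ ^ 2 =
      2 * Real.pi * ∫ y in Ioi (0 : ℝ), y ^ (2 * σ - 1) * ‖f y‖ ^ 2 := by
  -- The substitution y = e^{-u} turns the Mellin transform on Re s = σ into the Fourier transform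
  -- of h.
  set h : ℝ → ℂ := fun u => Real.exp (-σ * u) • f (Real.exp (-u)) with hh
  have hc : HasCompactSupport h := by
    refine HasCompactSupport.intro (isCompact_Icc (a := -Real.log b) (b := -Real.log a)) ?_
    intro u hu
    have : f (Real.exp (-u)) = 0 := image_eq_zero_of_notMem_tsupport fun hm => hu ?_
    · simp [hh, this]
    · have := hs hm
      have hb : 0 < b := (Real.exp_pos _).trans this.2
      have h1 := (Real.log_lt_iff_lt_exp ha).2 this.1
      have h2 := (Real.lt_log_iff_exp_lt hb).2 this.2
      exact ⟨by linarith, by linarith⟩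
  have hd : ContDiff ℝ (⊤ : ℕ∞) h := by
    exact (Real.contDiff_exp.comp (contDiff_const.mul contDiff_id)).smul
      (hf.comp (Real.contDiff_exp.comp contDiff_neg))
  have key := SchwartzMap.integral_norm_sq_fourier (hc.toSchwartzMap hd)
  have h1 : ∀ t : ℝ, mellin f (σ + t * Complex.I) = 𝓕 h (t / (2 * Real.pi)) := fun t => by
    rw [mellin_eq_fourier]; simp [hh]
  simp_rw [h1]
  have h2 := MeasureTheory.Measure.integral_comp_div (fun ξ => ‖𝓕 h ξ‖ ^ 2) (2 * Real.pi)
  rw [h2, abs_of_pos (by positivity), smul_eq_mul]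
  congr 1
  have h3 : ∫ ξ, ‖𝓕 h ξ‖ ^ 2 = ∫ u, ‖h u‖ ^ 2 := key
  rw [h3]
  -- The change of variables in the L² norm is obtained by reading ∫ ‖h‖² as a Fourier transform at
  -- frequency 0, that is, as the Mellin transform of ‖f‖² at 2σ.
  have h4 := mellin_eq_fourier (fun y => ((‖f y‖ ^ 2 : ℝ) : ℂ)) (s := ((2 * σ : ℝ) : ℂ))
  simp only [Complex.ofReal_re, Complex.ofReal_im, zero_div] at h4
  rw [Real.fourier_eq] at h4
  simp only [inner_zero_right, neg_zero, AddChar.map_zero_eq_one, one_smul] at h4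
  have h5 : mellin (fun y => ((‖f y‖ ^ 2 : ℝ) : ℂ)) ((2 * σ : ℝ) : ℂ) =
      ((∫ y in Ioi (0 : ℝ), y ^ (2 * σ - 1) * ‖f y‖ ^ 2 : ℝ) : ℂ) := by
    rw [mellin, ← integral_complex_ofReal]
    refine MeasureTheory.setIntegral_congr_fun measurableSet_Ioi fun y hy => ?_
    have hy : 0 < y := hy
    simp only [smul_eq_mul]
    push_cast
    rw [Complex.ofReal_cpow hy.le]
    push_cast
    rfl
  rw [h5] at h4
  have h6 : ∀ u : ℝ, Real.exp (-(2 * σ) * u) • ((‖f (Real.exp (-u))‖ ^ 2 : ℝ) : ℂ) =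
      ((‖h u‖ ^ 2 : ℝ) : ℂ) := fun u => by
    have : ‖h u‖ ^ 2 = Real.exp (-(2 * σ) * u) * ‖f (Real.exp (-u))‖ ^ 2 := by
      rw [hh]
      simp only [norm_smul, Real.norm_eq_abs, Real.abs_exp]
      rw [mul_pow, ← Real.exp_nat_mul]
      congr 2
      push_cast; ring
    rw [this, Complex.real_smul, ← Complex.ofReal_mul]
  simp_rw [h6] at h4
  rw [integral_complex_ofReal] at h4
  exact_mod_cast h4.symm

end

/-! ### The resonator and its exact mean square. -/

/-- A cutoff supported so close to `1` that its dilates by `1, …, N` are disjoint. -/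
structure ResonatorData where
  /-- number of dilates -/
  N : ℕ
  /-- left end of the window -/
  w : ℝ
  /-- left end of the support -/
  y₀ : ℝ
  /-- right end of the support -/
  y₁ : ℝ
  /-- the cutoff -/
  b : ℝ → ℝ
  w_pos : 0 < w
  w_lt : w < y₀
  le : y₀ ≤ y₁
  lt_one : y₁ < 1
  smooth : ContDiff ℝ (⊤ : ℕ∞) b
  supp : tsupport b ⊆ Ioo y₀ y₁
  disj : (N : ℝ) ≤ w * (N + 1)

namespace ResonatorData

variable (D : ResonatorData) (c : ℕ → ℝ)

/-- The resonating test function. -/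
noncomputable def res (T y : ℝ) : ℂ := ∑ m ∈ Finset.Icc 1 D.N, (c m : ℂ) * oscTest D.b T (m * y)

/-- The associated Dirichlet polynomial. -/
noncomputable def dirPoly (s : ℂ) : ℂ := ∑ m ∈ Finset.Icc 1 D.N, (c m : ℂ) * (m : ℂ) ^ (-s)

/-- The squared mass of the cutoff. -/
noncomputable def mass (σ : ℝ) : ℝ := ∫ y in Ioi (0 : ℝ), y ^ (2 * σ - 1) * D.b y ^ 2

lemma y₀_pos : 0 < D.y₀ := D.w_pos.trans D.w_lt

lemma w_lt_one : D.w < 1 := D.w_lt.trans (D.le.trans_lt D.lt_one)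

lemma b_eq_zero {y : ℝ} (hy : y ∉ Ioo D.y₀ D.y₁) : D.b y = 0 :=
  image_eq_zero_of_notMem_tsupport fun h => hy (D.supp h)

lemma contDiff_oscTest (T : ℝ) : ContDiff ℝ (⊤ : ℕ∞) (oscTest D.b T) := by
  have h1 : ContDiff ℝ (⊤ : ℕ∞) (fun y : ℝ => (y : ℂ)) := Complex.ofRealCLM.contDiff
  exact (h1.comp D.smooth).mul
    (Complex.contDiff_exp.comp ((contDiff_const.mul h1).mul contDiff_const).neg)

lemma tsupport_oscTest (T : ℝ) : tsupport (oscTest D.b T) ⊆ Ioo D.y₀ D.y₁ :=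
  tsupport_mul_subset_left.trans ((tsupport_comp_subset Complex.ofReal_zero D.b).trans D.supp)

lemma contDiff_res (T : ℝ) : ContDiff ℝ (⊤ : ℕ∞) (D.res c T) := by
  refine ContDiff.sum fun m _ => contDiff_const.mul ?_
  exact (D.contDiff_oscTest T).comp (contDiff_const.mul contDiff_id)

lemma oscTest_eq_zero {T y : ℝ} (hy : y ∉ Ioo D.y₀ D.y₁) : oscTest D.b T y = 0 := by
  simp [oscTest, D.b_eq_zero hy]

lemma tsupport_res (T : ℝ) : tsupport (D.res c T) ⊆ Ioo (D.w / (D.N + 1)) 1 := by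
  have hN : (0 : ℝ) < D.N + 1 := by positivity
  have h1 : tsupport (D.res c T) ⊆ Icc (D.y₀ / (D.N + 1)) D.y₁ := by
    refine closure_minimal (fun y hy => ?_) isClosed_Icc
    by_contra hcon
    refine hy (Finset.sum_eq_zero fun m hm => ?_)
    rw [Finset.mem_Icc] at hm
    have hm1 : (1 : ℝ) ≤ m := by exact_mod_cast hm.1
    have hm2 : (m : ℝ) ≤ D.N := by exact_mod_cast hm.2
    rw [D.oscTest_eq_zero, mul_zero]
    intro hmem
    have hy0 : 0 < y := by
      have := D.y₀_pos.trans hmem.1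
      exact pos_of_mul_pos_right this (by positivity)
    refine hcon ⟨?_, ?_⟩
    · rw [div_le_iff₀ hN]
      nlinarith [hmem.1]
    · nlinarith [hmem.2]
  refine h1.trans fun y hy => ⟨lt_of_lt_of_le ?_ hy.1, hy.2.trans_lt D.lt_one⟩
  exact div_lt_div_of_pos_right D.w_lt hN

lemma left_pos : 0 < D.w / (D.N + 1) := div_pos D.w_pos (by positivity)

/-- Dilation by m multiplies a Mellin transform by m^{-s}, so superposing dilates amounts to
multiplying by a Dirichlet polynomial. -/
lemma mellin_res (T : ℝ) (s : ℂ) :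
    mellin (D.res c T) s = D.dirPoly c s * mellin (oscTest D.b T) s := by
  have hconv : ∀ m ∈ Finset.Icc 1 D.N,
      MellinConvergent (fun y => (c m : ℂ) * oscTest D.b T (m * y)) s := fun m hm => by
    have hm0 : (0 : ℝ) < m := by exact_mod_cast (Finset.mem_Icc.1 hm).1
    exact ((MellinConvergent.comp_mul_left hm0).2 (mellinConvergent_of_tsupport_subset D.y₀_pos
      (D.contDiff_oscTest T).continuous (D.tsupport_oscTest T) s)).const_smul (c m : ℂ)
  have h1 : mellin (D.res c T) s =
      ∑ m ∈ Finset.Icc 1 D.N, mellin (fun y => (c m : ℂ) * oscTest D.b T (m * y)) s := by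
    simp only [mellin]
    rw [← MeasureTheory.integral_finsetSum _ hconv]
    simp only [res, Finset.smul_sum]
  rw [h1, dirPoly, Finset.sum_mul]
  refine Finset.sum_congr rfl fun m hm => ?_
  have hm0 : (0 : ℝ) < m := by exact_mod_cast (Finset.mem_Icc.1 hm).1
  have h2 := mellin_const_smul (fun y => oscTest D.b T (m * y)) s (c m : ℂ)
  simp only [smul_eq_mul] at h2
  rw [h2, mellin_comp_mul_left _ _ hm0]
  simp [mul_assoc]

lemma norm_oscTest (b : ℝ → ℝ) (T y : ℝ) : ‖oscTest b T y‖ = |b y| := by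
  have : (-(T * y * Complex.I : ℂ)).re = 0 := by simp
  rw [oscTest, norm_mul, Complex.norm_exp, this, Real.exp_zero, mul_one, Complex.norm_real,
    Real.norm_eq_abs]

/-- From my > w and (m+1)y ≤ ny < 1 would follow m(1-w) > w, whereas `disj` says N(1-w) ≤ w and m ≤
N. -/
lemma disjoint_dilates {y : ℝ} {m n : ℕ} (hmn : m < n) (hn : n ≤ D.N)
    (h1 : (m : ℝ) * y ∈ Ioo D.y₀ D.y₁) (h2 : (n : ℝ) * y ∈ Ioo D.y₀ D.y₁) : False := by
  have hm1 : (m : ℝ) + 1 ≤ n := by exact_mod_cast hmn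
  have hn1 : (n : ℝ) ≤ D.N := by exact_mod_cast hn
  have hy0 : 0 < y := pos_of_mul_pos_right (D.y₀_pos.trans h1.1) (by positivity)
  have h3 : (m + 1) * y < 1 := by
    have := h2.2.trans D.lt_one
    nlinarith
  have h4 : D.w < m * y := D.w_lt.trans h1.1
  have h5 : (m : ℝ) * (1 - D.w) ≤ D.w := by
    have := D.disj
    nlinarith [D.w_lt_one]
  nlinarith [D.w_pos, m.cast_nonneg (α := ℝ)]

/-- At each y at most one dilate is nonzero, so there are no cross terms, and the unimodular phases
disappear together with T. -/
lemma norm_res_sq (T y : ℝ) :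
    ‖D.res c T y‖ ^ 2 = ∑ m ∈ Finset.Icc 1 D.N, c m ^ 2 * D.b (m * y) ^ 2 := by
  by_cases h : ∃ m ∈ Finset.Icc 1 D.N, (m : ℝ) * y ∈ Ioo D.y₀ D.y₁
  · obtain ⟨m, hm, hmy⟩ := h
    have hne : ∀ n ∈ Finset.Icc 1 D.N, n ≠ m → (n : ℝ) * y ∉ Ioo D.y₀ D.y₁ := by
      intro n hn hnm hny
      rcases lt_or_gt_of_ne hnm with h | h
      · exact D.disjoint_dilates h (Finset.mem_Icc.1 hm).2 hny hmy
      · exact D.disjoint_dilates h (Finset.mem_Icc.1 hn).2 hmy hny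
    rw [res, Finset.sum_eq_single_of_mem m hm fun n hn hnm => by
        rw [D.oscTest_eq_zero (hne n hn hnm), mul_zero],
      Finset.sum_eq_single_of_mem m hm fun n hn hnm => by
        rw [D.b_eq_zero (hne n hn hnm)]; ring]
    rw [norm_mul, norm_oscTest, Complex.norm_real, Real.norm_eq_abs, mul_pow, sq_abs, sq_abs]
  · push Not at h
    rw [res, Finset.sum_eq_zero fun n hn => by rw [D.oscTest_eq_zero (h n hn), mul_zero],
      Finset.sum_eq_zero fun n hn => by rw [D.b_eq_zero (h n hn)]; ring]
    simp

lemma integrableOn_rpow_mul_b_sq (σ : ℝ) :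
    MeasureTheory.IntegrableOn (fun y => y ^ (2 * σ - 1) * D.b y ^ 2) (Ioi 0) := by
  have h1 : MeasureTheory.IntegrableOn (fun y => y ^ (2 * σ - 1) * D.b y ^ 2) (Icc D.y₀ D.y₁) := by
    refine ContinuousOn.integrableOn_Icc (ContinuousOn.mul ?_ (D.smooth.continuous.pow 2).continuousOn)
    exact ContinuousOn.rpow_const (by fun_prop) fun y hy => Or.inl (D.y₀_pos.trans_le hy.1).ne'
  refine (h1.integrable_of_forall_notMem_eq_zero fun y hy => ?_).integrableOn
  rw [D.b_eq_zero fun h => hy (Ioo_subset_Icc_self h)]; ring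

lemma setIntegral_comp_mul {m : ℕ} (hm : 1 ≤ m) (σ : ℝ) :
    ∫ y in Ioi (0 : ℝ), y ^ (2 * σ - 1) * D.b (m * y) ^ 2 = (m : ℝ) ^ (-(2 * σ)) * D.mass σ := by
  have hm0 : (0 : ℝ) < m := by exact_mod_cast hm
  have h1 := MeasureTheory.integral_comp_mul_left_Ioi
    (fun y : ℝ => y ^ (2 * σ - 1) * D.b y ^ 2) 0 hm0
  rw [mul_zero, smul_eq_mul] at h1
  have h2 : ∫ y in Ioi (0 : ℝ), (m * y) ^ (2 * σ - 1) * D.b (m * y) ^ 2 =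
      (m : ℝ) ^ (2 * σ - 1) * ∫ y in Ioi (0 : ℝ), y ^ (2 * σ - 1) * D.b (m * y) ^ 2 := by
    rw [← MeasureTheory.integral_const_mul]
    refine MeasureTheory.setIntegral_congr_fun measurableSet_Ioi fun y hy => ?_
    have hy : 0 < y := hy
    rw [Real.mul_rpow hm0.le hy.le]; ring
  rw [h2] at h1
  have h3 : (m : ℝ) ^ (2 * σ - 1) ≠ 0 := (Real.rpow_pos_of_pos hm0 _).ne'
  rw [mass]
  rw [← mul_right_inj' h3, h1, ← mul_assoc, ← Real.rpow_add hm0]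
  congr 1
  rw [show 2 * σ - 1 + -(2 * σ) = -1 by ring, Real.rpow_neg_one]

/-- Plancherel followed by diagonality: the mean square is exact and independent of T. -/
lemma integral_norm_mellin_res_sq (T σ : ℝ) :
    ∫ t : ℝ, ‖mellin (D.res c T) (σ + t * Complex.I)‖ ^ 2 =
      2 * Real.pi * ((∑ m ∈ Finset.Icc 1 D.N, c m ^ 2 * (m : ℝ) ^ (-(2 * σ))) * D.mass σ) := by
  rw [integral_norm_mellin_sq D.left_pos (D.contDiff_res c T) (D.tsupport_res c T)]
  congr 1
  simp_rw [norm_res_sq, Finset.mul_sum]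
  have hint : ∀ m ∈ Finset.Icc 1 D.N, MeasureTheory.IntegrableOn
      (fun y => y ^ (2 * σ - 1) * (c m ^ 2 * D.b (m * y) ^ 2)) (Ioi 0) := by
    intro m hm
    have hm0 : (0 : ℝ) < m := by exact_mod_cast (Finset.mem_Icc.1 hm).1
    have h1 := (MeasureTheory.integrableOn_Ioi_comp_mul_left_iff _ 0 hm0).2
      (by simpa using D.integrableOn_rpow_mul_b_sq σ)
    refine MeasureTheory.IntegrableOn.congr_fun
      (h1.const_mul (c m ^ 2 * ((m : ℝ) ^ (2 * σ - 1))⁻¹)) (fun y hy => ?_)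
      measurableSet_Ioi
    have hy : 0 < y := hy
    have h3 : (m : ℝ) ^ (2 * σ - 1) ≠ 0 := (Real.rpow_pos_of_pos hm0 _).ne'
    rw [Real.mul_rpow hm0.le hy.le]
    field_simp
  rw [MeasureTheory.integral_finsetSum _ hint, Finset.sum_mul]
  refine Finset.sum_congr rfl fun m hm => ?_
  rw [mul_assoc, ← D.setIntegral_comp_mul (Finset.mem_Icc.1 hm).1, ← MeasureTheory.integral_const_mul]
  congr 1; ext y; ring

end ResonatorData

/-! ### Decay of the transformed resonator and Cauchy–Schwarz on the window. -/

namespace ResonatorData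

variable (D : ResonatorData) (c : ℕ → ℝ)

lemma exists_norm_dirPoly_le (A : ℝ) : ∃ K, 0 ≤ K ∧ ∀ s : ℂ, A ≤ s.re → ‖D.dirPoly c s‖ ≤ K := by
  refine ⟨∑ m ∈ Finset.Icc 1 D.N, |c m| * (m : ℝ) ^ (-A), by positivity, fun s hs => ?_⟩
  refine norm_sum_le_of_le _ fun m hm => ?_
  have hm1 : 1 ≤ m := (Finset.mem_Icc.1 hm).1
  have hm1' : (1 : ℝ) ≤ m := by exact_mod_cast hm1
  rw [norm_mul, Complex.norm_real, Real.norm_eq_abs, Complex.norm_natCast_cpow_of_pos hm1]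
  gcongr
  simpa using hs

/-- Decay of the transformed resonator off its window. -/
lemma exists_norm_mellin_res_le (A B : ℝ) (n : ℕ) : ∃ C, 0 ≤ C ∧ ∀ (s : ℂ) (T : ℝ),
    s.re ∈ Icc A B → 0 < T → s.im ∉ Icc (D.w * T) T →
      ‖mellin (D.res c T) s‖ * (|s.im| + T) ^ n ≤ C := by
  obtain ⟨K, hK0, hK⟩ := D.exists_norm_dirPoly_le c A
  obtain ⟨C, hC0, hC⟩ := exists_norm_mellin_oscTest_le D.w_pos.le D.w_lt D.le D.lt_one D.smooth
    D.supp A B n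
  refine ⟨K * C, by positivity, fun s T hs hT him => ?_⟩
  rw [mellin_res, norm_mul, mul_assoc]
  exact mul_le_mul (hK s hs.1) (hC s T hs hT him) (by positivity) hK0

lemma exists_norm_mellin_res_le_const (A B : ℝ) : ∃ C, 0 ≤ C ∧ ∀ (s : ℂ) (T : ℝ),
    s.re ∈ Icc A B → ‖mellin (D.res c T) s‖ ≤ C := by
  obtain ⟨K, hK0, hK⟩ := D.exists_norm_dirPoly_le c A
  obtain ⟨C, hC0, hC⟩ := exists_norm_mellin_oscTest_le_const D.y₀_pos D.le D.smooth.continuous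
    D.supp A B
  refine ⟨K * C, by positivity, fun s T hs => ?_⟩
  rw [mellin_res, norm_mul]
  exact mul_le_mul (hK s hs.1) (hC s T hs) (by positivity) hK0

/-- Rapid decay of the transformed resonator for fixed `T`. -/
lemma exists_norm_mellin_res_mul_le (A B : ℝ) (n : ℕ) {T : ℝ} (hT : 1 ≤ T) : ∃ C, 0 ≤ C ∧
    ∀ s : ℂ, s.re ∈ Icc A B → ‖mellin (D.res c T) s‖ * (1 + |s.im|) ^ n ≤ C := by
  obtain ⟨C₁, h10, h1⟩ := D.exists_norm_mellin_res_le c A B n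
  obtain ⟨C₂, h20, h2⟩ := D.exists_norm_mellin_res_le_const c A B
  have hT0 : 0 < T := zero_lt_one.trans_le hT
  refine ⟨C₁ + C₂ * (1 + T) ^ n, by positivity, fun s hs => ?_⟩
  by_cases him : s.im ∈ Icc (D.w * T) T
  · have h3 : |s.im| ≤ T := by
      rw [abs_of_nonneg ((mul_pos D.w_pos hT0).le.trans him.1)]
      exact him.2
    calc _ ≤ C₂ * (1 + T) ^ n := by
          gcongr
          exact h2 s T hs
      _ ≤ _ := by linarith
  · calc _ ≤ ‖mellin (D.res c T) s‖ * (|s.im| + T) ^ n := by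
          rw [add_comm 1]
          gcongr
      _ ≤ C₁ := h1 s T hs hT0 him
      _ ≤ _ := by
          have : 0 ≤ C₂ * (1 + T) ^ n := by positivity
          linarith

lemma differentiable_mellin_res (T : ℝ) : Differentiable ℂ (mellin (D.res c T)) :=
  differentiable_mellin_of_tsupport_subset D.left_pos (D.contDiff_res c T).continuous
    (D.tsupport_res c T)

lemma continuous_mellin_res_line (T σ : ℝ) :
    Continuous fun t : ℝ => mellin (D.res c T) (σ + t * Complex.I) := by
  have := (D.differentiable_mellin_res c T).continuous
  fun_prop

lemma integrable_mul_mellin_res {g : ℝ → ℂ} (hg : Continuous g) {K : ℝ} {k : ℕ}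
    (hgK : ∀ t, ‖g t‖ ≤ K * (1 + |t|) ^ k) {T : ℝ} (hT : 1 ≤ T) (σ : ℝ) :
    MeasureTheory.Integrable fun t : ℝ => g t * mellin (D.res c T) (σ + t * Complex.I) := by
  obtain ⟨C, hC0, hC⟩ := D.exists_norm_mellin_res_mul_le c σ σ (k + 2) hT
  have hK0 : 0 ≤ K := by
    have := (norm_nonneg _).trans (hgK 0)
    simpa using this
  refine MeasureTheory.Integrable.mono' (integrable_inv_one_add_sq.const_mul (K * C))
    (hg.mul (D.continuous_mellin_res_line c T σ)).aestronglyMeasurable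
    (Eventually.of_forall fun t => ?_)
  have h1 := hC (σ + t * Complex.I) (by simp)
  have him : ((σ : ℂ) + t * Complex.I).im = t := by simp
  rw [him] at h1
  rw [norm_mul, mul_comm (K * C), ← div_eq_inv_mul, le_div_iff₀ (by positivity)]
  have h2 : 1 + t ^ 2 ≤ (1 + |t|) ^ 2 := by nlinarith [abs_nonneg t, sq_abs t]
  calc _ ≤ K * (1 + |t|) ^ k * ‖mellin (D.res c T) (σ + t * Complex.I)‖ * (1 + |t|) ^ 2 := by
        gcongr
        exact hgK t
    _ = K * (‖mellin (D.res c T) (σ + t * Complex.I)‖ * (1 + |t|) ^ (k + 2)) := by ring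
    _ ≤ _ := by gcongr

/-- The part of a vertical integral off the window is small. -/
lemma exists_setIntegral_compl_le (σ : ℝ) (k : ℕ) : ∃ C, 0 ≤ C ∧ ∀ T : ℝ, 1 ≤ T →
    ∫ t in (Icc (D.w * T) T)ᶜ, (1 + |t|) ^ k * ‖mellin (D.res c T) (σ + t * Complex.I)‖ ≤
      C / T := by
  -- Of the k + 3 powers of decay, k absorb the weight, two give integrability in t and one gives
  -- the factor 1/T.
  obtain ⟨C, hC0, hC⟩ := D.exists_norm_mellin_res_le c σ σ (k + 3)
  refine ⟨C * ∫ t : ℝ, (1 + t ^ 2)⁻¹, by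
    have : 0 ≤ ∫ t : ℝ, (1 + t ^ 2)⁻¹ := MeasureTheory.integral_nonneg fun t => by positivity
    positivity, fun T hT => ?_⟩
  have hT0 : 0 < T := zero_lt_one.trans_le hT
  have hint := integrable_inv_one_add_sq.const_mul (C / T)
  have hle : ∫ t in (Icc (D.w * T) T)ᶜ, (1 + |t|) ^ k * ‖mellin (D.res c T) (σ + t * Complex.I)‖ ≤
      ∫ t in (Icc (D.w * T) T)ᶜ, C / T * (1 + t ^ 2)⁻¹ := by
    refine MeasureTheory.setIntegral_mono_on ?_ hint.integrableOn measurableSet_Icc.compl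
      fun t ht => ?_
    · have h := (D.integrable_mul_mellin_res c (g := fun t => (((1 + |t|) ^ k : ℝ) : ℂ))
        (by fun_prop) (K := 1) (k := k) (fun t => by
          rw [Complex.norm_real, Real.norm_of_nonneg (by positivity), one_mul]) hT σ).norm
      refine h.integrableOn.congr_fun (fun t _ => ?_) measurableSet_Icc.compl
      simp only [norm_mul, Complex.norm_real]
      rw [Real.norm_of_nonneg (by positivity)]
    · have h1 := hC (σ + t * Complex.I) T (by simp) hT0 (by simpa using ht)
      have him : ((σ : ℂ) + t * Complex.I).im = t := by simp
      rw [him] at h1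
      rw [← div_eq_mul_inv, div_div, le_div_iff₀ (by positivity)]
      refine le_trans ?_ h1
      have h2 : 1 + t ^ 2 ≤ (|t| + T) ^ 2 := by nlinarith [abs_nonneg t, sq_abs t]
      have h3 : 1 + |t| ≤ |t| + T := by linarith
      calc _ = ‖mellin (D.res c T) (σ + t * Complex.I)‖ * ((1 + |t|) ^ k * T * (1 + t ^ 2)) := by
            ring
        _ ≤ ‖mellin (D.res c T) (σ + t * Complex.I)‖ *
            ((|t| + T) ^ k * (|t| + T) * (|t| + T) ^ 2) := by
            gcongr
            linarith [abs_nonneg t]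
        _ = _ := by ring
  refine hle.trans ((MeasureTheory.setIntegral_le_integral hint
    (Eventually.of_forall fun t => by positivity)).trans_eq ?_)
  rw [MeasureTheory.integral_const_mul]
  ring

/-- The square root of the mean square of the transformed resonator. -/
noncomputable def energy (σ : ℝ) : ℝ :=
  2 * Real.pi * ((∑ m ∈ Finset.Icc 1 D.N, c m ^ 2 * (m : ℝ) ^ (-(2 * σ))) * D.mass σ)

lemma integrable_norm_mellin_res_sq {T : ℝ} (hT : 1 ≤ T) (σ : ℝ) :
    MeasureTheory.Integrable fun t : ℝ => ‖mellin (D.res c T) (σ + t * Complex.I)‖ ^ 2 := by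
  obtain ⟨C, hC0, hC⟩ := D.exists_norm_mellin_res_le_const c σ σ
  have h := (D.integrable_mul_mellin_res c
    (g := fun t => mellin (D.res c T) (σ + t * Complex.I)) (K := C) (k := 0)
    (D.continuous_mellin_res_line c T σ) (fun t => by simpa using hC _ T (by simp)) hT σ).norm
  refine h.congr (Eventually.of_forall fun t => ?_)
  simp only [norm_mul, sq]

/-- Cauchy–Schwarz on the window. -/
lemma setIntegral_norm_mellin_res_le {T : ℝ} (hT : 1 ≤ T) (σ : ℝ) :
    ∫ t in Icc (D.w * T) T, ‖mellin (D.res c T) (σ + t * Complex.I)‖ ≤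
      √((1 - D.w) * T) * √(D.energy c σ) := by
  have hT0 : 0 < T := zero_lt_one.trans_le hT
  have hwT : D.w * T ≤ T := by nlinarith [D.w_lt_one]
  set f : ℝ → ℝ := fun t => ‖mellin (D.res c T) (σ + t * Complex.I)‖
  have hf : Continuous f := (D.continuous_mellin_res_line c T σ).norm
  have h2 : ∫ t in Icc (D.w * T) T, f t ^ 2 ≤ D.energy c σ := by
    refine (MeasureTheory.setIntegral_le_integral (D.integrable_norm_mellin_res_sq c hT σ)
      (Eventually.of_forall fun t => by positivity)).trans_eq ?_
    exact D.integral_norm_mellin_res_sq c T σ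
  have hCS := MeasureTheory.integral_mul_le_Lp_mul_Lq_of_nonneg
    (μ := MeasureTheory.volume.restrict (Icc (D.w * T) T)) (f := fun _ => (1 : ℝ)) (g := f)
    Real.HolderConjugate.two_two (Eventually.of_forall fun _ => zero_le_one)
    (Eventually.of_forall fun _ => norm_nonneg _)
    (MeasureTheory.memLp_const _)
    (by
      rw [ENNReal.ofReal_ofNat]
      rw [MeasureTheory.memLp_two_iff_integrable_sq hf.aestronglyMeasurable]
      exact (D.integrable_norm_mellin_res_sq c hT σ).integrableOn)
  simp only [one_mul, MeasureTheory.integral_const, smul_eq_mul, Real.rpow_two,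
    ← Real.sqrt_eq_rpow] at hCS
  refine hCS.trans ?_
  refine mul_le_mul ?_ (Real.sqrt_le_sqrt h2) (Real.sqrt_nonneg _) (Real.sqrt_nonneg _)
  refine Real.sqrt_le_sqrt (le_of_eq ?_)
  simp [Real.volume_real_Icc_of_le hwT]
  ring

end ResonatorData

/-! ### The Dirichlet series of the derivatives. -/

lemma norm_pole_term (ℓ : ℕ) (s : ℂ) :
    ‖((-1) ^ ℓ * ℓ.factorial / (s - 1) ^ (ℓ + 1) : ℂ)‖ = ℓ.factorial / ‖s - 1‖ ^ (ℓ + 1) := by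
  simp

/-- Termwise differentiation of ∑ n^{-s}. The n = 0 term vanishes even for ℓ = 0 because 0^{-s} = 0.
The absolute summability serves later to interchange sum and integral. -/
lemma hasSum_iteratedDeriv_riemannZeta (ℓ : ℕ) {s : ℂ} (hs : 1 < s.re) :
    HasSum (fun n : ℕ => (-1) ^ ℓ * (((Real.log n) ^ ℓ : ℝ) : ℂ) * (n : ℂ) ^ (-s))
      (iteratedDeriv ℓ riemannZeta s) ∧
    Summable (fun n : ℕ => |Real.log n| ^ ℓ * (n : ℝ) ^ (-s.re)) := by
  have hs0 : s ≠ 0 := fun h => by simp [h] at hs; linarith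
  have hab : LSeries.abscissaOfAbsConv 1 < s.re := by
    rw [LSeries.abscissaOfAbsConv_one]
    exact_mod_cast hs
  have h1 : riemannZeta =ᶠ[𝓝 s] LSeries 1 := by
    filter_upwards [(isOpen_lt continuous_const Complex.continuous_re).mem_nhds hs] with z hz
    exact (LSeries_one_eq_riemannZeta hz).symm
  have hterm : ∀ n : ℕ, LSeries.term (LSeries.logMul^[ℓ] 1) s n =
      (((Real.log n) ^ ℓ : ℝ) : ℂ) * (n : ℂ) ^ (-s) := by
    intro n
    have hl : ∀ k : ℕ, (LSeries.logMul^[k] (1 : ℕ → ℂ)) n = Complex.log n ^ k := by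
      intro k
      induction k with
      | zero => simp
      | succ k ih =>
        rw [Function.iterate_succ_apply', LSeries.logMul, ih, pow_succ, mul_comm]
    rcases eq_or_ne n 0 with rfl | hn
    · simp [LSeries.term_zero, Complex.zero_cpow (neg_ne_zero.2 hs0)]
    · rw [LSeries.term_of_ne_zero hn, hl, Complex.cpow_neg, div_eq_mul_inv, Complex.ofReal_pow,
        Complex.natCast_log]
  have hsum : LSeriesSummable (LSeries.logMul^[ℓ] 1) s :=
    LSeriesSummable_of_abscissaOfAbsConv_lt_re
      (by rwa [LSeries.absicssaOfAbsConv_logPowMul])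
  constructor
  · rw [h1.iteratedDeriv_eq, LSeries_iteratedDeriv ℓ hab]
    have := hsum.LSeriesHasSum.mul_left ((-1 : ℂ) ^ ℓ)
    simpa only [hterm, mul_assoc] using this
  · refine hsum.norm.congr fun n => ?_
    rw [hterm, norm_mul, Complex.norm_real, norm_pow, Real.norm_eq_abs]
    congr 1
    rcases Nat.eq_zero_or_pos n with rfl | hn
    · rw [Nat.cast_zero, Nat.cast_zero, Complex.zero_cpow (neg_ne_zero.2 hs0),
        Real.zero_rpow (by linarith), norm_zero]
    · rw [Complex.norm_natCast_cpow_of_pos hn, Complex.neg_re]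

/-! ### Integrals against the resonator, and Mellin inversion. -/

namespace ResonatorData

variable (D : ResonatorData) (c : ℕ → ℝ)

/-- A vertical integral against the transformed resonator is controlled by the size of the
integrand on the window. -/
lemma exists_norm_integral_le (σ : ℝ) (k : ℕ) {K : ℝ} (hK : 0 ≤ K) : ∃ C, 0 ≤ C ∧ ∀ T : ℝ, 1 ≤ T →
    ∀ g : ℝ → ℂ, Continuous g → (∀ t, ‖g t‖ ≤ K * (1 + |t|) ^ k) →
    ∀ M, 0 ≤ M → (∀ t ∈ Icc (D.w * T) T, ‖g t‖ ≤ M) →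
      ‖∫ t : ℝ, g t * mellin (D.res c T) (σ + t * Complex.I)‖ ≤
        M * (√((1 - D.w) * T) * √(D.energy c σ)) + C / T := by
  obtain ⟨C, hC0, hC⟩ := D.exists_setIntegral_compl_le c σ k
  refine ⟨K * C, by positivity, fun T hT g hg hgK M hM0 hM => ?_⟩
  set F : ℝ → ℂ := fun t => mellin (D.res c T) (σ + t * Complex.I) with hF
  have hFi : ∀ k : ℕ, MeasureTheory.Integrable fun t : ℝ => (1 + |t|) ^ k * ‖F t‖ := fun k => by
    have h := (D.integrable_mul_mellin_res c (g := fun t => (((1 + |t|) ^ k : ℝ) : ℂ))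
        (by fun_prop) (K := 1) (k := k) (fun t => by
          rw [Complex.norm_real, Real.norm_of_nonneg (by positivity), one_mul]) hT σ).norm
    refine h.congr (Eventually.of_forall fun t => ?_)
    simp only [norm_mul, Complex.norm_real]
    rw [Real.norm_of_nonneg (by positivity)]
  have hint := (D.integrable_mul_mellin_res c hg hgK hT σ).norm
  refine (MeasureTheory.norm_integral_le_integral_norm _).trans ?_
  rw [← MeasureTheory.integral_add_compl (measurableSet_Icc (a := D.w * T) (b := T)) hint]
  refine add_le_add ?_ ?_
  · calc ∫ t in Icc (D.w * T) T, ‖g t * F t‖ ≤ ∫ t in Icc (D.w * T) T, M * ‖F t‖ := by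
          refine MeasureTheory.setIntegral_mono_on hint.integrableOn ?_ measurableSet_Icc
            fun t ht => ?_
          · have := (hFi 0).const_mul M
            simp only [pow_zero, one_mul] at this
            exact this.integrableOn
          · rw [norm_mul]
            exact mul_le_mul_of_nonneg_right (hM t ht) (norm_nonneg _)
      _ = M * ∫ t in Icc (D.w * T) T, ‖F t‖ := MeasureTheory.integral_const_mul _ _
      _ ≤ _ := mul_le_mul_of_nonneg_left (D.setIntegral_norm_mellin_res_le c hT σ) hM0
  · calc ∫ t in (Icc (D.w * T) T)ᶜ, ‖g t * F t‖ ≤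
        ∫ t in (Icc (D.w * T) T)ᶜ, K * ((1 + |t|) ^ k * ‖F t‖) := by
          refine MeasureTheory.setIntegral_mono_on hint.integrableOn
            ((hFi k).const_mul K).integrableOn measurableSet_Icc.compl fun t ht => ?_
          rw [norm_mul, ← mul_assoc]
          exact mul_le_mul_of_nonneg_right (hgK t) (norm_nonneg _)
      _ = K * ∫ t in (Icc (D.w * T) T)ᶜ, (1 + |t|) ^ k * ‖F t‖ :=
          MeasureTheory.integral_const_mul _ _
      _ ≤ K * (C / T) := mul_le_mul_of_nonneg_left (hC T hT) hK
      _ = _ := by ring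

lemma norm_cpow_line {X : ℝ} (hX : 0 < X) (σ t : ℝ) :
    ‖(X : ℂ) ^ ((σ : ℂ) + t * Complex.I)‖ = X ^ σ := by
  rw [Complex.norm_cpow_eq_rpow_re_of_pos hX]; simp

lemma continuous_cpow_line {X : ℝ} (hX : 0 < X) (σ : ℝ) :
    Continuous fun t : ℝ => (X : ℂ) ^ ((σ : ℂ) + t * Complex.I) := by
  refine Continuous.const_cpow (by fun_prop) (Or.inl ?_)
  exact_mod_cast hX.ne'

/-- The resonance: for T = 2πX the phase at n/X is e^{-2πimn} = 1, so only the real amplitudes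
remain. -/
lemma res_natCast {T X : ℝ} (hX : 0 < X) (hTX : T = 2 * Real.pi * X) (n : ℕ) :
    D.res c T (n / X) = ((∑ m ∈ Finset.Icc 1 D.N, c m * D.b (m * (n / X)) : ℝ) : ℂ) := by
  rw [res]
  push_cast
  refine Finset.sum_congr rfl fun m _ => ?_
  rw [oscTest]
  have h : -((T : ℂ) * ((m * (n / X) : ℝ) : ℂ) * Complex.I) =
      -((m * n : ℕ) * (2 * Real.pi * Complex.I)) := by
    have : (X : ℂ) ≠ 0 := by exact_mod_cast hX.ne'
    rw [hTX]
    push_cast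
    field_simp
  rw [h, Complex.exp_neg, Complex.exp_nat_mul_two_pi_mul_I]
  simp

/-- Mellin inversion for the resonator. -/
lemma integral_cpow_mul_mellin_res {T x : ℝ} (hT : 1 ≤ T) (hx : 0 < x) (σ : ℝ) :
    ∫ t : ℝ, (x : ℂ) ^ (-((σ : ℂ) + t * Complex.I)) * mellin (D.res c T) (σ + t * Complex.I) =
      2 * Real.pi * D.res c T x := by
  have h := mellinInv_mellin_eq σ (D.res c T) hx
    (mellinConvergent_of_tsupport_subset D.left_pos (D.contDiff_res c T).continuous
      (D.tsupport_res c T) _)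
    (by
      have := D.integrable_mul_mellin_res c (g := fun _ => 1) (K := 1) (k := 0) (by fun_prop)
        (by simp) hT σ
      simpa [Complex.VerticalIntegrable] using this)
    (D.contDiff_res c T).continuous.continuousAt
  rw [mellinInv] at h
  rw [← h, Complex.real_smul]
  have : (Real.pi : ℂ) ≠ 0 := by exact_mod_cast Real.pi_ne_zero
  push_cast
  simp only [smul_eq_mul]
  rw [← mul_assoc, mul_one_div_cancel (mul_ne_zero two_ne_zero this), one_mul]

/-- On Re s = σ > 1 the Dirichlet series converges absolutely and may be integrated termwise; each
term is a Mellin inversion at n/X, where the phases are trivial. -/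
lemma hasSum_log_pow_mul_b (ℓ : ℕ) {T X σ : ℝ} (hT : 1 ≤ T) (hX : 0 < X)
    (hTX : T = 2 * Real.pi * X) (hσ : 1 < σ) :
    HasSum (fun n : ℕ => (((Real.log n) ^ ℓ *
        ∑ m ∈ Finset.Icc 1 D.N, c m * D.b (m * (n / X)) : ℝ) : ℂ))
      ((-1) ^ ℓ / (2 * Real.pi) * ∫ t : ℝ, iteratedDeriv ℓ riemannZeta (σ + t * Complex.I) *
        (X : ℂ) ^ ((σ : ℂ) + t * Complex.I) * mellin (D.res c T) (σ + t * Complex.I)) := by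
  set F : ℝ → ℂ := fun t => mellin (D.res c T) (σ + t * Complex.I) with hF
  have hre : ∀ t : ℝ, ((σ : ℂ) + t * Complex.I).re = σ := fun t => by simp
  have hs0 : ∀ t : ℝ, (-((σ : ℂ) + t * Complex.I)) ≠ 0 := fun t h => by
    have := congrArg Complex.re h
    simp at this; linarith
  set f : ℕ → ℝ → ℂ := fun n t => (-1) ^ ℓ * (((Real.log n) ^ ℓ : ℝ) : ℂ) *
    (n : ℂ) ^ (-((σ : ℂ) + t * Complex.I)) * (X : ℂ) ^ ((σ : ℂ) + t * Complex.I) * F t with hf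
  have hnorm : ∀ n t, ‖f n t‖ = |Real.log n| ^ ℓ * (n : ℝ) ^ (-σ) * X ^ σ * ‖F t‖ := by
    intro n t
    have h1 : ‖(n : ℂ) ^ (-((σ : ℂ) + t * Complex.I))‖ = (n : ℝ) ^ (-σ) := by
      rcases Nat.eq_zero_or_pos n with rfl | hn
      · rw [Nat.cast_zero, Complex.zero_cpow (hs0 t), Nat.cast_zero,
          Real.zero_rpow (by linarith), norm_zero]
      · rw [Complex.norm_natCast_cpow_of_pos hn]; simp
    simp only [hf, norm_mul, norm_pow, norm_neg, norm_one, one_pow, one_mul, Complex.norm_real,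
      Real.norm_eq_abs, h1, norm_cpow_line hX]
  have hcn : ∀ n : ℕ, Continuous fun t : ℝ => (n : ℂ) ^ (-((σ : ℂ) + t * Complex.I)) := fun n => by
    refine continuous_iff_continuousAt.2 fun t => ?_
    exact ContinuousAt.const_cpow (by fun_prop) (Or.inr (hs0 t))
  have hFi : MeasureTheory.Integrable F := by
    have := D.integrable_mul_mellin_res c (g := fun _ => 1) (K := 1) (k := 0) (by fun_prop)
      (by simp) hT σ
    simpa using this
  have hint : ∀ n, MeasureTheory.Integrable (f n) := fun n => by
    refine MeasureTheory.Integrable.mono'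
      (hFi.norm.const_mul (|Real.log n| ^ ℓ * (n : ℝ) ^ (-σ) * X ^ σ)) ?_
      (Eventually.of_forall fun t => (hnorm n t).le)
    refine Continuous.aestronglyMeasurable ?_
    exact ((continuous_const.mul (hcn n)).mul (continuous_cpow_line hX σ)).mul
      (D.continuous_mellin_res_line c T σ)
  have hsum : Summable fun n => ∫ t, ‖f n t‖ := by
    simp_rw [hnorm, MeasureTheory.integral_const_mul]
    have := (hasSum_iteratedDeriv_riemannZeta ℓ (s := σ) (by simpa using hσ)).2
    simp only [Complex.ofReal_re] at this
    exact (this.mul_right _).mul_right _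
  have key := MeasureTheory.hasSum_integral_of_summable_integral_norm hint hsum
  have h1 : ∀ t, ∑' n, f n t = iteratedDeriv ℓ riemannZeta (σ + t * Complex.I) *
      (X : ℂ) ^ ((σ : ℂ) + t * Complex.I) * F t := fun t => by
    have := (hasSum_iteratedDeriv_riemannZeta ℓ (s := σ + t * Complex.I) (by rwa [hre])).1
    exact ((this.mul_right _).mul_right _).tsum_eq
  simp_rw [h1] at key
  have hpi : (Real.pi : ℂ) ≠ 0 := by exact_mod_cast Real.pi_ne_zero
  have h2 : ∀ n : ℕ, ∫ t, f n t = (-1) ^ ℓ * (2 * Real.pi) * (((Real.log n) ^ ℓ *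
      ∑ m ∈ Finset.Icc 1 D.N, c m * D.b (m * (n / X)) : ℝ) : ℂ) := by
    intro n
    rcases Nat.eq_zero_or_pos n with rfl | hn
    · have hz : ∀ t, f 0 t = 0 := fun t => by
        simp only [hf, Nat.cast_zero, Complex.zero_cpow (hs0 t), mul_zero, zero_mul]
      have hb0 : D.b 0 = 0 := D.b_eq_zero fun h => absurd h.1 (not_lt.2 D.y₀_pos.le)
      simp [hz, hb0]
    · have hn0 : (0 : ℝ) < n := by exact_mod_cast hn
      have h3 : ∀ t, f n t = (-1) ^ ℓ * (((Real.log n) ^ ℓ : ℝ) : ℂ) *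
          (((n / X : ℝ) : ℂ) ^ (-((σ : ℂ) + t * Complex.I)) * F t) := fun t => by
        have : ((n / X : ℝ) : ℂ) ^ (-((σ : ℂ) + t * Complex.I)) =
            (n : ℂ) ^ (-((σ : ℂ) + t * Complex.I)) * (X : ℂ) ^ ((σ : ℂ) + t * Complex.I) := by
          rw [div_eq_mul_inv, Complex.ofReal_mul,
            Complex.mul_cpow_ofReal_nonneg hn0.le (inv_pos.2 hX).le, Complex.ofReal_inv,
            Complex.inv_cpow _ _ (by rw [Complex.arg_ofReal_of_nonneg hX.le]; exact Real.pi_pos.ne),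
            Complex.cpow_neg (X : ℂ), inv_inv]
          simp
        simp only [hf]
        rw [this]; ring
      simp_rw [h3, MeasureTheory.integral_const_mul]
      rw [D.integral_cpow_mul_mellin_res c hT (div_pos hn0 hX) σ, D.res_natCast c hX hTX]
      push_cast
      ring
  have h4 := key.mul_left ((-1) ^ ℓ / (2 * Real.pi) : ℂ)
  have h5 : ((-1) ^ ℓ / (2 * Real.pi) : ℂ) * ((-1) ^ ℓ * (2 * Real.pi)) = 1 := by
    have : ((-1 : ℂ) ^ ℓ) * (-1) ^ ℓ = 1 := by rw [← mul_pow]; simp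
    field_simp
    linear_combination this
  have h6 : ∀ n, (-1) ^ ℓ / (2 * Real.pi) * ∫ t, f n t = (((Real.log n) ^ ℓ *
      ∑ m ∈ Finset.Icc 1 D.N, c m * D.b (m * (n / X)) : ℝ) : ℂ) := fun n => by
    rw [h2, ← mul_assoc, h5, one_mul]
  simp only [h6] at h4
  exact h4

end ResonatorData

/-! ### Size of the zeta derivatives on vertical lines. -/

lemma line_sub_one_norm_ge {σ : ℝ} (t : ℝ) :
    |σ - 1| ≤ ‖(σ : ℂ) + t * Complex.I - 1‖ ∧ |t| ≤ ‖(σ : ℂ) + t * Complex.I - 1‖ := by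
  constructor
  · simpa using Complex.abs_re_le_norm ((σ : ℂ) + t * Complex.I - 1)
  · simpa using Complex.abs_im_le_norm ((σ : ℂ) + t * Complex.I - 1)

lemma line_ne_one {σ : ℝ} (hσ : σ ≠ 1) (t : ℝ) : (σ : ℂ) + t * Complex.I ≠ 1 := fun h => by
  have := congrArg Complex.re h
  simp at this
  exact hσ this

lemma continuous_pole_line (ℓ : ℕ) {σ : ℝ} (hσ : σ ≠ 1) :
    Continuous fun t : ℝ => ((-1) ^ ℓ * ℓ.factorial / ((σ : ℂ) + t * Complex.I - 1) ^ (ℓ + 1) : ℂ) :=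
  continuous_const.div (by fun_prop) fun t => pow_ne_zero _ (sub_ne_zero.2 (line_ne_one hσ t))

lemma continuous_iteratedDeriv_riemannZeta_line (ℓ : ℕ) {σ : ℝ} (hσ : σ ≠ 1) :
    Continuous fun t : ℝ => iteratedDeriv ℓ riemannZeta ((σ : ℂ) + t * Complex.I) := by
  simp_rw [fun t : ℝ => iteratedDeriv_riemannZeta_eq ℓ (line_ne_one hσ t)]
  have := (differentiable_iteratedDeriv_riemannZeta₀ ℓ).continuous
  exact (continuous_pole_line ℓ hσ).add (by fun_prop)

lemma one_add_norm_le (s : ℂ) {R : ℝ} (hR : |s.re| ≤ R) : 1 + ‖s‖ ≤ (1 + R) * (1 + |s.im|) := by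
  have h1 := Complex.norm_le_abs_re_add_abs_im s
  nlinarith [abs_nonneg s.im, abs_nonneg s.re]

lemma exists_norm_iteratedDeriv_riemannZeta_line_le (ℓ : ℕ) {σ : ℝ} (hσ : σ ≠ 1) :
    ∃ (K : ℝ) (k : ℕ), 0 ≤ K ∧ ∀ t : ℝ,
      ‖iteratedDeriv ℓ riemannZeta ((σ : ℂ) + t * Complex.I)‖ ≤ K * (1 + |t|) ^ k := by
  obtain ⟨C, B, hC0, hC⟩ := exists_norm_iteratedDeriv_riemannZeta₀_le ℓ σ
  have hσ' : 0 < |σ - 1| := abs_pos.2 (sub_ne_zero.2 hσ)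
  refine ⟨ℓ.factorial / |σ - 1| ^ (ℓ + 1) + C * (1 + |σ|) ^ B, B, by positivity, fun t => ?_⟩
  rw [iteratedDeriv_riemannZeta_eq ℓ (line_ne_one hσ t)]
  refine (norm_add_le _ _).trans ?_
  rw [norm_pole_term, add_mul]
  have h1 : (1 : ℝ) ≤ (1 + |t|) ^ B := one_le_pow₀ (by linarith [abs_nonneg t])
  refine add_le_add ?_ ?_
  · refine le_trans ?_ (le_mul_of_one_le_right (by positivity) h1)
    gcongr
    exact (line_sub_one_norm_ge t).1
  · refine (hC _ (by simp)).trans ?_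
    rw [mul_assoc, ← mul_pow]
    have := one_add_norm_le ((σ : ℂ) + t * Complex.I) (R := |σ|) (by simp)
    simp only [Complex.add_im, Complex.ofReal_im, Complex.mul_im, Complex.ofReal_re, Complex.I_im,
      mul_one, Complex.I_re, mul_zero, add_zero, zero_add] at this
    gcongr

/-! ### Contour shift and the resonance inequality. -/

namespace ResonatorData

variable (D : ResonatorData) (c : ℕ → ℝ)

/-- X^{it} is unimodular and can be absorbed into the integrand, which leaves X^σ outside and a
constant independent of X. -/
lemma exists_norm_line_integral_le (σ : ℝ) {h : ℝ → ℂ} (hh : Continuous h) {K : ℝ} {k : ℕ}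
    (hK0 : 0 ≤ K) (hK : ∀ t, ‖h t‖ ≤ K * (1 + |t|) ^ k) : ∃ C, 0 ≤ C ∧ ∀ T : ℝ, 1 ≤ T →
    ∀ X : ℝ, 0 < X → ∀ M, 0 ≤ M → (∀ t ∈ Icc (D.w * T) T, ‖h t‖ ≤ M) →
      ‖∫ t : ℝ, h t * (X : ℂ) ^ ((σ : ℂ) + t * Complex.I) *
        mellin (D.res c T) (σ + t * Complex.I)‖ ≤
        X ^ σ * (M * (√((1 - D.w) * T) * √(D.energy c σ)) + C / T) := by
  obtain ⟨C, hC0, hC⟩ := D.exists_norm_integral_le c σ k hK0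
  refine ⟨C, hC0, fun T hT X hX M hM0 hM => ?_⟩
  have hX1 : ∀ t : ℝ, ‖(X : ℂ) ^ (((0 : ℝ) : ℂ) + t * Complex.I)‖ = 1 := fun t => by
    rw [norm_cpow_line hX, Real.rpow_zero]
  have h1 := hC T hT (fun t => h t * (X : ℂ) ^ (((0 : ℝ) : ℂ) + t * Complex.I))
    (hh.mul (continuous_cpow_line hX 0)) (fun t => by rw [norm_mul, hX1, mul_one]; exact hK t)
    M hM0 (fun t ht => by rw [norm_mul, hX1, mul_one]; exact hM t ht)
  have hXc : (X : ℂ) ≠ 0 := by exact_mod_cast hX.ne'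
  have h2 : ∀ t : ℝ, h t * (X : ℂ) ^ ((σ : ℂ) + t * Complex.I) *
      mellin (D.res c T) (σ + t * Complex.I) = ((X ^ σ : ℝ) : ℂ) *
      (h t * (X : ℂ) ^ (((0 : ℝ) : ℂ) + t * Complex.I) *
        mellin (D.res c T) (σ + t * Complex.I)) := fun t => by
    rw [Complex.ofReal_zero, zero_add, Complex.cpow_add _ _ hXc, Complex.ofReal_cpow hX.le]
    ring
  simp_rw [h2]
  rw [MeasureTheory.integral_const_mul, norm_mul, Complex.norm_real,
    Real.norm_of_nonneg (Real.rpow_nonneg hX.le _)]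
  gcongr

/-- On the window |s - 1| ≥ wT, so the polar term is O(1/T) there, against an L¹ norm O(√T) of the
transform. This makes it unnecessary to compute a residue. -/
lemma exists_norm_pole_integral_le (ℓ : ℕ) {σ : ℝ} (hσ : σ ≠ 1) : ∃ C, 0 ≤ C ∧ ∀ T : ℝ, 1 ≤ T →
    ∀ X : ℝ, 0 < X →
      ‖∫ t : ℝ, ((-1) ^ ℓ * ℓ.factorial / ((σ : ℂ) + t * Complex.I - 1) ^ (ℓ + 1) : ℂ) *
        (X : ℂ) ^ ((σ : ℂ) + t * Complex.I) * mellin (D.res c T) (σ + t * Complex.I)‖ ≤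
        X ^ σ * (C / √T) := by
  have hσ' : 0 < |σ - 1| := abs_pos.2 (sub_ne_zero.2 hσ)
  obtain ⟨C, hC0, hC⟩ := D.exists_norm_line_integral_le c σ (continuous_pole_line ℓ hσ)
    (K := ℓ.factorial / |σ - 1| ^ (ℓ + 1)) (k := 0) (by positivity) (fun t => by
      rw [norm_pole_term, pow_zero, mul_one]
      gcongr
      exact (line_sub_one_norm_ge t).1)
  have hw := D.w_pos
  have hw1 := D.w_lt_one
  refine ⟨ℓ.factorial / D.w ^ (ℓ + 1) * (√(1 - D.w) * √(D.energy c σ)) + C, by positivity,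
    fun T hT X hX => ?_⟩
  have hT0 : 0 < T := zero_lt_one.trans_le hT
  have hTs : 0 < √T := Real.sqrt_pos.2 hT0
  refine (hC T hT X hX (ℓ.factorial / D.w ^ (ℓ + 1) / T) (by positivity) fun t ht => ?_).trans ?_
  · rw [norm_pole_term, div_div]
    have h1 : D.w * T ≤ ‖(σ : ℂ) + t * Complex.I - 1‖ :=
      ht.1.trans ((le_abs_self t).trans (line_sub_one_norm_ge t).2)
    have h2 : D.w ^ (ℓ + 1) * T ≤ (D.w * T) ^ (ℓ + 1) := by
      rw [mul_pow]
      gcongr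
      exact le_self_pow₀ hT (by omega)
    gcongr
    exact h2.trans (by gcongr)
  · gcongr
    rw [Real.sqrt_mul (by linarith), add_div]
    have h3 : √T / T = 1 / √T := by rw [Real.sqrt_div_self']
    refine add_le_add (le_of_eq ?_) ?_
    · calc _ = ℓ.factorial / D.w ^ (ℓ + 1) * (√(1 - D.w) * √(D.energy c σ)) * (√T / T) := by ring
        _ = _ := by rw [h3]; ring
    · gcongr
      rw [Real.sqrt_le_left hT0.le]
      nlinarith

/-- Moving the line of integration for the entire part of the zeta derivative. -/
lemma integral_shift (ℓ : ℕ) {σ σ' T X : ℝ} (hσ : σ ≤ σ') (hT : 1 ≤ T) (hX : 1 ≤ X) :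
    ∫ t : ℝ, iteratedDeriv ℓ riemannZeta₀ (σ + t * Complex.I) *
      (X : ℂ) ^ ((σ : ℂ) + t * Complex.I) * mellin (D.res c T) (σ + t * Complex.I) =
    ∫ t : ℝ, iteratedDeriv ℓ riemannZeta₀ (σ' + t * Complex.I) *
      (X : ℂ) ^ ((σ' : ℂ) + t * Complex.I) * mellin (D.res c T) (σ' + t * Complex.I) := by
  have hX0 : 0 < X := zero_lt_one.trans_le hX
  have hXc : (X : ℂ) ≠ 0 := by exact_mod_cast hX0.ne'
  obtain ⟨C, B, hC0, hC⟩ := exists_norm_iteratedDeriv_riemannZeta₀_le ℓ σ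
  obtain ⟨C', hC'0, hC'⟩ := D.exists_norm_mellin_res_mul_le c σ σ' (B + 2) hT
  have hd : Differentiable ℂ fun s : ℂ =>
      iteratedDeriv ℓ riemannZeta₀ s * (X : ℂ) ^ s * mellin (D.res c T) s :=
    ((differentiable_iteratedDeriv_riemannZeta₀ ℓ).mul
      (differentiable_id.const_cpow (Or.inl hXc))).mul (D.differentiable_mellin_res c T)
  refine integral_vertical_eq_of_decay hd hσ
    (C := C * (1 + (|σ| + |σ'|)) ^ B * X ^ σ' * C') fun s hs => ?_
  have hR : |s.re| ≤ |σ| + |σ'| := by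
    rw [abs_le]
    exact ⟨by linarith [neg_abs_le σ, abs_nonneg σ', hs.1], by linarith [le_abs_self σ', abs_nonneg σ, hs.2]⟩
  have h1 : ‖iteratedDeriv ℓ riemannZeta₀ s‖ ≤
      C * (1 + (|σ| + |σ'|)) ^ B * (1 + |s.im|) ^ B := by
    refine (hC s hs.1).trans ?_
    rw [mul_assoc, ← mul_pow]
    gcongr
    exact one_add_norm_le s hR
  have h2 : ‖(X : ℂ) ^ s‖ ≤ X ^ σ' := by
    rw [Complex.norm_cpow_eq_rpow_re_of_pos hX0]
    exact Real.rpow_le_rpow_of_exponent_le hX hs.2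
  rw [norm_mul, norm_mul]
  calc _ ≤ C * (1 + (|σ| + |σ'|)) ^ B * (1 + |s.im|) ^ B * X ^ σ' * ‖mellin (D.res c T) s‖ *
        (1 + |s.im|) ^ 2 := by gcongr
    _ = C * (1 + (|σ| + |σ'|)) ^ B * X ^ σ' *
        (‖mellin (D.res c T) s‖ * (1 + |s.im|) ^ (B + 2)) := by ring
    _ ≤ _ := by
      gcongr
      exact hC' s hs

/-- The zeta integral splits into its polar and its entire part. -/
lemma integral_zeta_eq_add (ℓ : ℕ) {σ T X : ℝ} (hσ : σ ≠ 1) (hT : 1 ≤ T) (hX : 0 < X) :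
    ∫ t : ℝ, iteratedDeriv ℓ riemannZeta (σ + t * Complex.I) *
      (X : ℂ) ^ ((σ : ℂ) + t * Complex.I) * mellin (D.res c T) (σ + t * Complex.I) =
    (∫ t : ℝ, ((-1) ^ ℓ * ℓ.factorial / ((σ : ℂ) + t * Complex.I - 1) ^ (ℓ + 1) : ℂ) *
      (X : ℂ) ^ ((σ : ℂ) + t * Complex.I) * mellin (D.res c T) (σ + t * Complex.I)) +
    ∫ t : ℝ, iteratedDeriv ℓ riemannZeta₀ (σ + t * Complex.I) *
      (X : ℂ) ^ ((σ : ℂ) + t * Complex.I) * mellin (D.res c T) (σ + t * Complex.I) := by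
  have hσ' : 0 < |σ - 1| := abs_pos.2 (sub_ne_zero.2 hσ)
  obtain ⟨C, B, hC0, hC⟩ := exists_norm_iteratedDeriv_riemannZeta₀_le ℓ σ
  rw [← MeasureTheory.integral_add]
  · congr 1
    ext t
    rw [iteratedDeriv_riemannZeta_eq ℓ (line_ne_one hσ t)]
    ring
  · refine D.integrable_mul_mellin_res c ((continuous_pole_line ℓ hσ).mul
      (continuous_cpow_line hX σ)) (K := ℓ.factorial / |σ - 1| ^ (ℓ + 1) * X ^ σ) (k := 0)
      (fun t => ?_) hT σ
    rw [Pi.mul_apply, norm_mul, norm_pole_term, norm_cpow_line hX, pow_zero, mul_one]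
    gcongr
    exact (line_sub_one_norm_ge t).1
  · have := (differentiable_iteratedDeriv_riemannZeta₀ ℓ).continuous
    refine D.integrable_mul_mellin_res c (Continuous.mul (by fun_prop)
      (continuous_cpow_line hX σ)) (K := C * (1 + |σ|) ^ B * X ^ σ) (k := B)
      (fun t => ?_) hT σ
    have h1 := one_add_norm_le ((σ : ℂ) + t * Complex.I) (R := |σ|) (by simp)
    simp only [Complex.add_im, Complex.ofReal_im, Complex.mul_im, Complex.ofReal_re, Complex.I_im,
      mul_one, Complex.I_re, mul_zero, add_zero, zero_add] at h1
    rw [Pi.mul_apply, norm_mul, norm_cpow_line hX]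
    calc _ ≤ C * (1 + ‖(σ : ℂ) + t * Complex.I‖) ^ B * X ^ σ := by
          gcongr
          exact hC _ (by simp)
      _ ≤ C * ((1 + |σ|) * (1 + |t|)) ^ B * X ^ σ := by gcongr
      _ = _ := by rw [mul_pow]; ring

/-- The resonance inequality: the coefficient sum is bounded by the maximum on the window. -/
lemma exists_resonance_inequality (ℓ : ℕ) {σ : ℝ} (hσ : σ < 1 / 2) : ∃ C, 0 ≤ C ∧
    ∀ T X S M : ℝ, T = 2 * Real.pi * X → 1 ≤ X → 0 ≤ M →
    (∀ t ∈ Icc (D.w * T) T, ‖iteratedDeriv ℓ riemannZeta ((σ : ℂ) + t * Complex.I)‖ ≤ M) →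
    HasSum (fun n : ℕ => (Real.log n) ^ ℓ *
      ∑ m ∈ Finset.Icc 1 D.N, c m * D.b (m * (n / X))) S →
    2 * Real.pi * |S| ≤ X ^ σ * (M * (√((1 - D.w) * T) * √(D.energy c σ))) +
      C * X ^ (3 / 4 : ℝ) := by
  have hσ1 : σ ≠ 1 := by linarith
  obtain ⟨K, k, hK0, hK⟩ := exists_norm_iteratedDeriv_riemannZeta_line_le ℓ hσ1
  obtain ⟨C₁, h10, h1⟩ := D.exists_norm_line_integral_le c σ
    (continuous_iteratedDeriv_riemannZeta_line ℓ hσ1) hK0 hK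
  obtain ⟨C₂, h20, h2⟩ := D.exists_norm_pole_integral_le c ℓ hσ1
  -- The abscissa 5/4 exceeds 1, for the Dirichlet series, and stays below 3/2, so that the polar
  -- error X^{5/4}/√T ≤ X^{3/4} is o(X).
  obtain ⟨C₃, h30, h3⟩ := D.exists_norm_pole_integral_le c ℓ (σ := 5 / 4) (by norm_num)
  refine ⟨C₁ + C₂ + C₃, by positivity, fun T X S M hTX hX hM0 hM hS => ?_⟩
  have hX0 : 0 < X := zero_lt_one.trans_le hX
  have hXT : X ≤ T := by
    rw [hTX]
    nlinarith [Real.pi_gt_three]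
  have hT : 1 ≤ T := hX.trans hXT
  have hT0 : 0 < T := zero_lt_one.trans_le hT
  have hS' := D.hasSum_log_pow_mul_b c ℓ (σ := 5 / 4) hT hX0 hTX (by norm_num)
  have hSeq := (Complex.hasSum_ofReal.2 hS).unique hS'
  have e1 := D.integral_zeta_eq_add c ℓ (σ := 5 / 4) (by norm_num) hT hX0
  have e2 := D.integral_zeta_eq_add c ℓ hσ1 hT hX0
  have e3 := D.integral_shift c ℓ (σ := σ) (σ' := 5 / 4) (by linarith) hT hX
  have b1 := h1 T hT X hX0 M hM0 hM
  have b2 := h2 T hT X hX0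
  have b3 := h3 T hT X hX0
  -- Only the entire part is shifted: the integral at 5/4 equals its polar part plus the zeta
  -- integral at σ minus the polar part at σ.
  rw [e1, ← e3, ← sub_eq_iff_eq_add'.2 e2] at hSeq
  have hn : 2 * Real.pi * |S| = ‖(2 * Real.pi : ℂ) * S‖ := by
    rw [norm_mul, Complex.norm_real, Real.norm_eq_abs, norm_mul, Complex.norm_real,
      Real.norm_of_nonneg Real.pi_pos.le]
    simp
  have hpi : (Real.pi : ℂ) ≠ 0 := by exact_mod_cast Real.pi_ne_zero
  set I₁ := ∫ t : ℝ, iteratedDeriv ℓ riemannZeta (σ + t * Complex.I) *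
      (X : ℂ) ^ ((σ : ℂ) + t * Complex.I) * mellin (D.res c T) (σ + t * Complex.I)
  set P₁ := ∫ t : ℝ, ((-1) ^ ℓ * ℓ.factorial / ((σ : ℂ) + t * Complex.I - 1) ^ (ℓ + 1) : ℂ) *
      (X : ℂ) ^ ((σ : ℂ) + t * Complex.I) * mellin (D.res c T) (σ + t * Complex.I)
  set P₂ := ∫ t : ℝ, ((-1) ^ ℓ * ℓ.factorial / (((5 / 4 : ℝ) : ℂ) + t * Complex.I - 1) ^ (ℓ + 1) : ℂ) *
      (X : ℂ) ^ (((5 / 4 : ℝ) : ℂ) + t * Complex.I) * mellin (D.res c T) ((5 / 4 : ℝ) + t * Complex.I)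
  have hn2 : 2 * Real.pi * |S| ≤ ‖P₂‖ + (‖I₁‖ + ‖P₁‖) := by
    rw [hn, hSeq, show (2 * Real.pi : ℂ) * ((-1) ^ ℓ / (2 * Real.pi) * (P₂ + (I₁ - P₁))) =
      (-1) ^ ℓ * (P₂ + (I₁ - P₁)) by field_simp, norm_mul, norm_pow, norm_neg, norm_one, one_pow,
      one_mul]
    exact (norm_add_le _ _).trans (by gcongr; exact norm_sub_le _ _)
  have hTs : 0 < √T := Real.sqrt_pos.2 hT0
  have hsX : X ^ (1 / 2 : ℝ) ≤ √T := by
    rw [← Real.sqrt_eq_rpow]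
    exact Real.sqrt_le_sqrt hXT
  have hσX : X ^ σ ≤ X ^ (1 / 2 : ℝ) := Real.rpow_le_rpow_of_exponent_le hX hσ.le
  have hX34 : 1 ≤ X ^ (3 / 4 : ℝ) := Real.one_le_rpow hX (by norm_num)
  have hTs1 : √T ≤ T := by
    rw [Real.sqrt_le_left hT0.le]
    nlinarith
  have k1 : X ^ σ * (C₁ / T) ≤ C₁ * X ^ (3 / 4 : ℝ) := by
    calc X ^ σ * (C₁ / T) ≤ T * (C₁ / T) := by
          gcongr
          linarith
      _ = C₁ * 1 := by field_simp
      _ ≤ _ := by gcongr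
  have k2 : X ^ σ * (C₂ / √T) ≤ C₂ * X ^ (3 / 4 : ℝ) := by
    calc X ^ σ * (C₂ / √T) ≤ √T * (C₂ / √T) := by
          gcongr
          linarith
      _ = C₂ * 1 := by field_simp
      _ ≤ _ := by gcongr
  have k3 : X ^ (5 / 4 : ℝ) * (C₃ / √T) ≤ C₃ * X ^ (3 / 4 : ℝ) := by
    have : X ^ (5 / 4 : ℝ) = X ^ (3 / 4 : ℝ) * X ^ (1 / 2 : ℝ) := by
      rw [← Real.rpow_add hX0]; norm_num
    rw [this]
    calc _ ≤ X ^ (3 / 4 : ℝ) * √T * (C₃ / √T) := by gcongr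
      _ = _ := by field_simp
  linarith

end ResonatorData

/-! ### Lower bound for the coefficient sum. -/

lemma tendsto_sum_rpow_neg {a : ℝ} (ha : 1 < a) :
    Tendsto (fun N : ℕ => ∑ m ∈ Finset.Icc 1 N, (m : ℝ) ^ (-a)) atTop (𝓝 (riemannZeta a).re) := by
  have hζ : HasSum (fun n : ℕ => (n + 1 : ℂ) ^ (-(a : ℂ))) (riemannZeta a) := by
    rw [zeta_eq_tsum_one_div_nat_add_one_cpow (by simpa using ha)]
    simpa [Complex.cpow_neg] using (summable_natCast_cpow (s := a) (by simpa using ha)).hasSum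
  have h1 := Complex.hasSum_re hζ
  have h2 : ∀ n : ℕ, ((n + 1 : ℂ) ^ (-(a : ℂ))).re = ((n + 1 : ℕ) : ℝ) ^ (-a) := fun n => by
    have : ((n + 1 : ℂ) ^ (-(a : ℂ))) = ((((n + 1 : ℕ) : ℝ) ^ (-a) : ℝ) : ℂ) := by
      rw [Complex.ofReal_cpow (by positivity)]
      push_cast
      rfl
    rw [this, Complex.ofReal_re]
  simp_rw [h2] at h1
  refine h1.tendsto_sum_nat.congr fun N => ?_
  rw [Finset.range_eq_Ico, Finset.sum_Ico_add' (fun m : ℕ => (m : ℝ) ^ (-a)) 0 N 1]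
  rfl

lemma natCast_floor_sub_ceil_le_card {α β : ℝ} (hα : 0 ≤ α) :
    β - α - 1 ≤ (Finset.Icc ⌈α⌉₊ ⌊β⌋₊).card := by
  rw [Nat.card_Icc]
  have h1 := Nat.lt_floor_add_one β
  have h2 := Nat.ceil_lt_add_one hα
  have h3 : ((⌊β⌋₊ + 1 : ℕ) : ℝ) - (⌈α⌉₊ : ℕ) ≤ ((⌊β⌋₊ + 1 - ⌈α⌉₊ : ℕ) : ℝ) := by
    rw [sub_le_iff_le_add]
    exact_mod_cast le_tsub_add
  push_cast at h3
  linarith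

namespace ResonatorData

variable (D : ResonatorData) (c : ℕ → ℝ)

/-- Lower bound for the coefficient sum. -/
lemma exists_hasSum_ge (ℓ : ℕ) (hc : ∀ m, 0 ≤ c m) (hb : ∀ y, 0 ≤ D.b y) {z₀ z₁ : ℝ} (h0 : 0 < z₀)
    (h1 : z₁ ≤ 1) (h01 : z₀ ≤ z₁) (hb1 : ∀ y ∈ Icc z₀ z₁, D.b y = 1) {X : ℝ} (hX0 : 0 < X)
    (hX : D.N ≤ z₀ * X) :
    ∃ S : ℝ, HasSum (fun n : ℕ => (Real.log n) ^ ℓ *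
      ∑ m ∈ Finset.Icc 1 D.N, c m * D.b (m * (n / X))) S ∧
      (Real.log (z₀ * X / D.N)) ^ ℓ *
        ((z₁ - z₀) * (∑ m ∈ Finset.Icc 1 D.N, c m / m) * X - ∑ m ∈ Finset.Icc 1 D.N, c m) ≤ S := by
  set a : ℕ → ℝ := fun n => (Real.log n) ^ ℓ *
      ∑ m ∈ Finset.Icc 1 D.N, c m * D.b (m * (n / X)) with ha
  have hsum : Summable a := by
    refine summable_of_hasFiniteSupport ((Finset.range (⌈X⌉₊ + 1)).finite_toSet.subset fun n hn => ?_)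
    by_contra hcon
    refine hn ?_
    simp only [Finset.coe_range, mem_Iio, not_lt] at hcon
    have hXn : X ≤ n := (Nat.le_ceil X).trans (by exact_mod_cast (by omega : ⌈X⌉₊ ≤ n))
    simp only [ha]
    rw [Finset.sum_eq_zero, mul_zero]
    intro m hm
    have hm1 : (1 : ℝ) ≤ m := by exact_mod_cast (Finset.mem_Icc.1 hm).1
    have : (1 : ℝ) ≤ n / X := by rwa [le_div_iff₀ hX0, one_mul]
    rw [D.b_eq_zero fun h => ?_, mul_zero]
    have := h.2.trans D.lt_one
    nlinarith
  have hnn : ∀ n, 0 ≤ a n := fun n => mul_nonneg (pow_nonneg (Real.log_natCast_nonneg n) _)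
    (Finset.sum_nonneg fun m _ => mul_nonneg (hc m) (hb _))
  refine ⟨∑' n, a n, hsum.hasSum, ?_⟩
  refine le_trans ?_ (hsum.sum_le_tsum (Finset.range (⌊X⌋₊ + 1)) fun n _ => hnn n)
  have hL : (Real.log (z₀ * X / D.N)) ^ ℓ *
      ((z₁ - z₀) * (∑ m ∈ Finset.Icc 1 D.N, c m / m) * X - ∑ m ∈ Finset.Icc 1 D.N, c m) =
      ∑ m ∈ Finset.Icc 1 D.N,
        (Real.log (z₀ * X / D.N)) ^ ℓ * ((z₁ - z₀) * (c m / m) * X - c m) := by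
    simp only [Finset.mul_sum, Finset.sum_mul, mul_sub, Finset.sum_sub_distrib]
  rw [hL]
  simp only [ha, Finset.mul_sum]
  rw [Finset.sum_comm]
  refine Finset.sum_le_sum fun m hm => ?_
  obtain ⟨hm1, hmN⟩ := Finset.mem_Icc.1 hm
  have hm1' : (1 : ℝ) ≤ m := by exact_mod_cast hm1
  have hm0 : (0 : ℝ) < m := by linarith
  have hmN' : (m : ℝ) ≤ D.N := by exact_mod_cast hmN
  have hN0 : (0 : ℝ) < D.N := by linarith
  have hlog : 0 ≤ Real.log (z₀ * X / D.N) := Real.log_nonneg ((one_le_div hN0).2 hX)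
  -- For these n the point mn/X lies on the plateau [z₀, z₁]. There are at least (z₁ - z₀)X/m - 1 of
  -- them, each with n ≥ z₀X/N; all other terms are nonnegative and are dropped.
  set I := Finset.Icc ⌈z₀ * X / m⌉₊ ⌊z₁ * X / m⌋₊ with hI
  have hz1 : 0 ≤ z₁ := h0.le.trans h01
  have hsub : I ⊆ Finset.range (⌊X⌋₊ + 1) := fun n hn => by
    rw [Finset.mem_range, Nat.lt_add_one_iff]
    refine (Finset.mem_Icc.1 hn).2.trans (Nat.floor_le_floor ?_)
    rw [div_le_iff₀ hm0]
    nlinarith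
  have hterm : ∀ n ∈ I, (Real.log (z₀ * X / D.N)) ^ ℓ * c m ≤
      (Real.log n) ^ ℓ * (c m * D.b (m * (n / X))) := fun n hn => by
    obtain ⟨hn1, hn2⟩ := Finset.mem_Icc.1 hn
    have hn1' : z₀ * X / m ≤ n := Nat.ceil_le.1 hn1
    have hn2' : (n : ℝ) ≤ z₁ * X / m := (Nat.le_floor_iff (by positivity)).1 hn2
    rw [div_le_iff₀ hm0] at hn1'
    rw [le_div_iff₀ hm0] at hn2'
    have hbn : D.b (m * (n / X)) = 1 := by
      refine hb1 _ ⟨?_, ?_⟩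
      · rw [← mul_div_assoc, le_div_iff₀ hX0]; linarith
      · rw [← mul_div_assoc, div_le_iff₀ hX0]; linarith
    rw [hbn, mul_one]
    have : z₀ * X / D.N ≤ n := by
      rw [div_le_iff₀ hN0]
      refine hn1'.trans ?_
      gcongr
    have hpos : 0 < z₀ * X / D.N := by positivity
    have := hc m
    gcongr
  calc _ = (Real.log (z₀ * X / D.N)) ^ ℓ * c m * (z₁ * X / m - z₀ * X / m - 1) := by ring
    _ ≤ (Real.log (z₀ * X / D.N)) ^ ℓ * c m * I.card := by
      have := hc m
      gcongr
      exact natCast_floor_sub_ceil_le_card (by positivity)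
    _ = ∑ n ∈ I, (Real.log (z₀ * X / D.N)) ^ ℓ * c m := by
      rw [Finset.sum_const, nsmul_eq_mul]; ring
    _ ≤ ∑ n ∈ I, (Real.log n) ^ ℓ * (c m * D.b (m * (n / X))) := Finset.sum_le_sum hterm
    _ ≤ _ := Finset.sum_le_sum_of_subset_of_nonneg hsub fun n _ _ =>
      mul_nonneg (pow_nonneg (Real.log_natCast_nonneg n) _) (mul_nonneg (hc m) (hb _))

end ResonatorData

/-! ### Choice of the cutoff. -/

/-- Resonators that are good enough for the mean value constant. -/
lemma exists_resonatorData {σ κ : ℝ} (hσ : σ < 1 / 2)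
    (hκ : κ < (riemannZeta ((2 - 2 * σ : ℝ) : ℂ)).re) (hκ0 : 0 ≤ κ) :
    ∃ (D : ResonatorData) (z₀ z₁ : ℝ), 1 ≤ D.N ∧ 0 < z₀ ∧ z₀ ≤ z₁ ∧ z₁ ≤ 1 ∧ (∀ y, 0 ≤ D.b y) ∧
      (∀ y ∈ Icc z₀ z₁, D.b y = 1) ∧
      κ * ((1 - D.w) * D.mass σ) <
        (z₁ - z₀) ^ 2 * ∑ m ∈ Finset.Icc 1 D.N, (m : ℝ) ^ (-(2 - 2 * σ)) := by
  obtain ⟨N, hN, hN1⟩ := (((tendsto_sum_rpow_neg (by linarith : 1 < 2 - 2 * σ)).eventually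
    (lt_mem_nhds hκ)).and (eventually_ge_atTop 1)).exists
  set A := ∑ m ∈ Finset.Icc 1 N, (m : ℝ) ^ (-(2 - 2 * σ)) with hA
  -- The required inequality after division by 4r², for a cutoff of width about 2r; at r = 0 it
  -- reads κ < A, which holds by the choice of N.
  have hcont : ContinuousAt (fun r : ℝ => (1 - r) ^ 2 * A -
      κ * ((1 + r) * (1 - 3 * r) ^ (2 * σ - 1))) 0 := by
    have : ContinuousAt (fun r : ℝ => (1 - 3 * r) ^ (2 * σ - 1)) 0 :=
      ContinuousAt.rpow_const (by fun_prop) (Or.inl (by norm_num))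
    fun_prop
  have h1 : ∀ᶠ r : ℝ in 𝓝[>] 0, 0 < (1 - r) ^ 2 * A -
      κ * ((1 + r) * (1 - 3 * r) ^ (2 * σ - 1)) := by
    refine (hcont.eventually (lt_mem_nhds (a := 0) ?_)).filter_mono nhdsWithin_le_nhds
    simpa using hN
  -- This smallness gives 1 - w = 2r + 2r² ≤ 1/(N+1), the disjointness condition.
  have h2 : ∀ᶠ r : ℝ in 𝓝[>] 0, r < 1 / (4 * (N + 1)) :=
    (gt_mem_nhds (show (0 : ℝ) < 1 / (4 * (N + 1)) by positivity)).filter_mono nhdsWithin_le_nhds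
  obtain ⟨r, ⟨hr1, hr2⟩, hr0⟩ := ((h1.and h2).and self_mem_nhdsWithin).exists
  have hr0 : 0 < r := hr0
  have hN1' : (1 : ℝ) ≤ N := by exact_mod_cast hN1
  rw [lt_div_iff₀ (by positivity)] at hr2
  have hr8 : r < 1 / 8 := by nlinarith
  have hrr : r ^ 2 < r / 8 := by nlinarith
  have hrr0 : 0 < r ^ 2 := by positivity
  -- Plateau of length 2r(1-r) inside a support of length 2r ending at 1 - r². The margins of order
  -- r² leave room for y₀, y₁ and w, with 1 - w = 2r(1+r).
  let f : ContDiffBump (1 - r - r ^ 2 : ℝ) := ⟨(1 - r) * r, r, by nlinarith, by nlinarith⟩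
  have hsupp : ∀ y, y ∉ Icc (1 - 2 * r - r ^ 2) (1 - r ^ 2) → f y = 0 := fun y hy => by
    refine f.zero_of_le_dist ?_
    rw [Real.dist_eq]
    by_contra h
    rw [not_le, abs_lt] at h
    have e : f.rOut = r := rfl
    rw [e] at h
    exact hy ⟨by linarith [h.1], by linarith [h.2]⟩
  have hts : tsupport f ⊆ Ioo (1 - 2 * r - 3 / 2 * r ^ 2) (1 - r ^ 2 / 2) := by
    have : tsupport f ⊆ Icc (1 - 2 * r - r ^ 2) (1 - r ^ 2) :=
      closure_minimal (fun y hy => by_contra fun h => hy (hsupp y h)) isClosed_Icc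
    exact this.trans fun y hy => ⟨by linarith [hy.1], by linarith [hy.2]⟩
  let D : ResonatorData :=
    { N := N
      w := 1 - 2 * r - 2 * r ^ 2
      y₀ := 1 - 2 * r - 3 / 2 * r ^ 2
      y₁ := 1 - r ^ 2 / 2
      b := f
      w_pos := by linarith
      w_lt := by linarith
      le := by linarith
      lt_one := by linarith
      smooth := f.contDiff
      supp := hts
      disj := by nlinarith }
  have hmass : D.mass σ ≤ 2 * r * (1 - 3 * r) ^ (2 * σ - 1) := by
    have e1 : D.mass σ = ∫ y in Icc (1 - 2 * r - r ^ 2) (1 - r ^ 2), y ^ (2 * σ - 1) * f y ^ 2 := by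
      refine MeasureTheory.setIntegral_eq_of_subset_of_forall_sdiff_eq_zero measurableSet_Ioi
        (fun y hy => ?_) fun y hy => ?_
      · have := hy.1
        show 0 < y
        linarith
      · have : D.b y = 0 := hsupp y hy.2
        rw [this]; ring
    rw [e1]
    have e2 : ∫ y in Icc (1 - 2 * r - r ^ 2) (1 - r ^ 2), (1 - 3 * r) ^ (2 * σ - 1) =
        2 * r * (1 - 3 * r) ^ (2 * σ - 1) := by
      rw [MeasureTheory.setIntegral_const, Real.volume_real_Icc_of_le (by linarith), smul_eq_mul]
      ring
    rw [← e2]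
    refine MeasureTheory.setIntegral_mono_on ?_ ?_ measurableSet_Icc fun y hy => ?_
    · refine (D.integrableOn_rpow_mul_b_sq σ).mono_set fun y hy => ?_
      have := hy.1
      show 0 < y
      linarith
    · exact MeasureTheory.integrableOn_const measure_Icc_lt_top.ne
    · have h3 : 0 < 1 - 3 * r := by linarith
      -- The exponent 2σ - 1 is negative, so the lower bound 1 - 3r for the support controls the
      -- weight.
      have h4 : y ^ (2 * σ - 1) ≤ (1 - 3 * r) ^ (2 * σ - 1) :=
        Real.rpow_le_rpow_of_nonpos h3 (by linarith [hy.1]) (by linarith)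
      have h5 : f y ^ 2 ≤ 1 := pow_le_one₀ f.nonneg f.le_one
      calc _ ≤ (1 - 3 * r) ^ (2 * σ - 1) * 1 := by
            gcongr
        _ = _ := mul_one _
  refine ⟨D, 1 - r - r ^ 2 - (1 - r) * r, 1 - r - r ^ 2 + (1 - r) * r, hN1, by nlinarith,
    by nlinarith, by nlinarith, fun y => f.nonneg, fun y hy => ?_, ?_⟩
  · refine f.one_of_mem_closedBall ?_
    rw [Real.closedBall_eq_Icc]
    exact hy
  · have e : 1 - D.w = 2 * r * (1 + r) := by
      show 1 - (1 - 2 * r - 2 * r ^ 2) = _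
      ring
    rw [e]
    calc κ * (2 * r * (1 + r) * D.mass σ) ≤
        κ * (2 * r * (1 + r) * (2 * r * (1 - 3 * r) ^ (2 * σ - 1))) := by gcongr
      _ = 4 * r ^ 2 * (κ * ((1 + r) * (1 - 3 * r) ^ (2 * σ - 1))) := by ring
      _ < 4 * r ^ 2 * ((1 - r) ^ 2 * A) := by
          exact mul_lt_mul_of_pos_left (by linarith) (by positivity)
      _ = _ := by
          show _ = _ * A
          ring

/-! ### Comparison of the two estimates and conclusion. -/

/-- This is the lower bound for the coefficient sum less the error C X^{3/4}/(2π), divided by X (log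
T)^ℓ, where X = T/(2π) and log T + d is the logarithm in the lower bound. -/
lemma tendsto_resonance_quotient (ℓ : ℕ) (d Q c₁ C : ℝ) :
    Tendsto (fun T : ℝ => (1 + d * (Real.log T)⁻¹) ^ ℓ * (Q - c₁ * (T / (2 * Real.pi))⁻¹) -
      C * (((T / (2 * Real.pi)) ^ (1 / 4 : ℝ))⁻¹ * ((Real.log T)⁻¹) ^ ℓ)) atTop (𝓝 Q) := by
  have h1 : Tendsto (fun T : ℝ => (Real.log T)⁻¹) atTop (𝓝 0) :=
    tendsto_inv_atTop_zero.comp Real.tendsto_log_atTop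
  have hX : Tendsto (fun T : ℝ => T / (2 * Real.pi)) atTop atTop :=
    tendsto_id.atTop_div_const (by positivity)
  have h2 : Tendsto (fun T : ℝ => (T / (2 * Real.pi))⁻¹) atTop (𝓝 0) :=
    tendsto_inv_atTop_zero.comp hX
  have h3 : Tendsto (fun T : ℝ => ((T / (2 * Real.pi)) ^ (1 / 4 : ℝ))⁻¹) atTop (𝓝 0) :=
    tendsto_inv_atTop_zero.comp ((tendsto_rpow_atTop (by norm_num)).comp hX)
  have h := ((((h1.const_mul d).const_add 1).pow ℓ).mul ((h2.const_mul c₁).const_sub Q)).sub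
    ((h3.mul (h1.pow ℓ)).const_mul C)
  simpa using h

/-- For large `T`, the mean value constant is a lower bound for the maximum. -/
lemma eventually_le_of_isGreatest (ℓ : ℕ) {β : ℝ} (hβ₁ : β < 1) {σ : ℝ} (hσ : σ < 1 / 2) {M : ℝ → ℝ}
    (hM : ∀ T : ℝ, 1 ≤ T →
      IsGreatest ((fun t : ℝ => ‖iteratedDeriv ℓ riemannZeta ((σ : ℂ) + (t : ℂ) * Complex.I)‖) ''
        Icc (T ^ β) T) (M T)) :
    ∀ᶠ T : ℝ in atTop,
      (2 * Real.pi) ^ (σ - 1 / 2) *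
        Real.sqrt ((riemannZeta ((2 - 2 * σ : ℝ) : ℂ)).re / (2 - 2 * σ)) *
        T ^ (1 / 2 - σ) * Real.log T ^ ℓ ≤ M T := by
  have hpi := Real.pi_pos
  have ha : 1 < 2 - 2 * σ := by linarith
  set κ := (riemannZeta ((2 - 2 * σ : ℝ) : ℂ)).re / (2 - 2 * σ) with hκ
  have hζ : 0 < (riemannZeta ((2 - 2 * σ : ℝ) : ℂ)).re := riemannZeta_re_pos_of_one_lt ha
  have hκ0 : 0 ≤ κ := by positivity
  -- The slack that makes o(1) superfluous: 2-2σ > 1, so κ is strictly below ζ(2-2σ).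
  obtain ⟨D, z₀, z₁, hN, hz0, hz01, hz1, hb0, hb1, hlt⟩ := exists_resonatorData hσ
    (div_lt_self hζ ha) hκ0
  set A := ∑ m ∈ Finset.Icc 1 D.N, (m : ℝ) ^ (-(2 - 2 * σ)) with hA
  -- The equality case of Cauchy–Schwarz between ∑ c_m/m and ∑ c_m² m^{-2σ}; both sums then equal A.
  set c : ℕ → ℝ := fun m => (m : ℝ) ^ (2 * σ - 1) with hc
  have hA1 : ∑ m ∈ Finset.Icc 1 D.N, c m / m = A := by
    refine Finset.sum_congr rfl fun m hm => ?_
    have hm0 : (0 : ℝ) < m := by exact_mod_cast (Finset.mem_Icc.1 hm).1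
    rw [hc, ← Real.rpow_sub_one hm0.ne']
    congr 1; ring
  have hA2 : ∑ m ∈ Finset.Icc 1 D.N, c m ^ 2 * (m : ℝ) ^ (-(2 * σ)) = A := by
    refine Finset.sum_congr rfl fun m hm => ?_
    have hm0 : (0 : ℝ) < m := by exact_mod_cast (Finset.mem_Icc.1 hm).1
    rw [hc, ← Real.rpow_natCast, ← Real.rpow_mul hm0.le, ← Real.rpow_add hm0]
    congr 1; push_cast; ring
  have hmass0 : 0 ≤ D.mass σ := MeasureTheory.setIntegral_nonneg measurableSet_Ioi fun y hy =>
    mul_nonneg (Real.rpow_nonneg (le_of_lt hy) _) (sq_nonneg _)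
  have hw0 : 0 < 1 - D.w := sub_pos.2 D.w_lt_one
  have hA0 : 0 < A := by
    have : 0 < (z₁ - z₀) ^ 2 * A := lt_of_le_of_lt (by positivity) hlt
    exact pos_of_mul_pos_right this (sq_nonneg _)
  have hPQ : √(κ * ((1 - D.w) * D.mass σ) * A) < (z₁ - z₀) * A := by
    rw [Real.sqrt_lt' (by
      refine mul_pos ?_ hA0
      refine lt_of_le_of_ne (sub_nonneg.2 hz01) fun h => ?_
      rw [← h] at hlt
      have : 0 ≤ κ * ((1 - D.w) * D.mass σ) := by positivity
      linarith)]
    calc κ * ((1 - D.w) * D.mass σ) * A < (z₁ - z₀) ^ 2 * A * A := mul_lt_mul_of_pos_right hlt hA0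
      _ = ((z₁ - z₀) * A) ^ 2 := by ring
  obtain ⟨C, hC0, hC⟩ := D.exists_resonance_inequality c ℓ hσ
  have hN0 : (0 : ℝ) < D.N := by exact_mod_cast hN
  have ev1 : ∀ᶠ T : ℝ in atTop, T ^ β ≤ D.w * T := by
    have h := (tendsto_rpow_neg_atTop (sub_pos.2 hβ₁)).eventually (gt_mem_nhds D.w_pos)
    filter_upwards [h, eventually_gt_atTop 0] with T hT hT0
    have : T ^ β = T ^ (-(1 - β)) * T := by
      rw [← Real.rpow_add_one hT0.ne']; congr 1; ring
    rw [this]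
    gcongr
  filter_upwards [ev1, eventually_ge_atTop (2 * Real.pi), eventually_gt_atTop (Real.exp 1),
    eventually_ge_atTop (2 * Real.pi * (D.N / z₀)),
    (tendsto_resonance_quotient ℓ (Real.log (z₀ / (2 * Real.pi * D.N))) ((z₁ - z₀) * A)
      (∑ m ∈ Finset.Icc 1 D.N, c m) (C / (2 * Real.pi))).eventually (lt_mem_nhds hPQ)]
    with T hT1 hT2 hT3 hT4 hT5
  -- If M(T) were smaller than the claimed bound Y, then Y would bound the derivative on the window,
  -- and the resonance inequality with Y would contradict the strict inequality of the leading
  -- constants.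
  by_contra hcon
  rw [not_le] at hcon
  have hT0 : 0 < T := lt_of_lt_of_le (by positivity) hT2
  have hT : 1 ≤ T := by linarith [Real.pi_gt_three]
  set X := T / (2 * Real.pi) with hXdef
  have hTX : T = 2 * Real.pi * X := by rw [hXdef]; field_simp
  have hX1 : 1 ≤ X := (one_le_div (by positivity)).2 hT2
  have hX0 : 0 < X := by linarith
  have hL : 1 < Real.log T := (Real.lt_log_iff_exp_lt hT0).2 hT3
  have hL0 : 0 < Real.log T := by linarith
  set Y := (2 * Real.pi) ^ (σ - 1 / 2) * √κ * T ^ (1 / 2 - σ) * Real.log T ^ ℓ with hY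
  have hY0 : 0 ≤ Y := by positivity
  have hYX : Y = X ^ (1 / 2 - σ) * √κ * Real.log T ^ ℓ := by
    have e : (2 * Real.pi) ^ (σ - 1 / 2) = ((2 * Real.pi) ^ (1 / 2 - σ))⁻¹ := by
      rw [← Real.rpow_neg (by positivity), neg_sub]
    rw [hY, hXdef, Real.div_rpow hT0.le (by positivity), e,
      div_eq_mul_inv (T ^ (1 / 2 - σ))]
    ring
  have hNX : D.N ≤ z₀ * X := by
    rw [hXdef, ← mul_div_assoc, le_div_iff₀ (by positivity)]
    calc D.N * (2 * Real.pi) = z₀ * (2 * Real.pi * (D.N / z₀)) := by field_simp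
      _ ≤ z₀ * T := by gcongr
  obtain ⟨S, hS, hSge⟩ := D.exists_hasSum_ge c ℓ (fun m => by positivity) hb0 hz0 hz1 hz01 hb1 hX0
    hNX
  have hineq := hC T X S Y hTX hX1 hY0 (fun t ht => by
    refine le_trans ((hM T hT).2 ⟨t, ⟨hT1.trans ht.1, ht.2⟩, rfl⟩) hcon.le) hS
  have hrhs : X ^ σ * (Y * (√((1 - D.w) * T) * √(D.energy c σ))) =
      2 * Real.pi * (X * Real.log T ^ ℓ * √(κ * ((1 - D.w) * D.mass σ) * A)) := by
    have e1 : √((1 - D.w) * T) * √(D.energy c σ) =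
        2 * Real.pi * √X * √((1 - D.w) * D.mass σ * A) := by
      rw [ResonatorData.energy, hA2, ← Real.sqrt_mul (by positivity), hTX,
        show (1 - D.w) * (2 * Real.pi * X) * (2 * Real.pi * (A * D.mass σ)) =
          (2 * Real.pi) ^ 2 * (X * ((1 - D.w) * D.mass σ * A)) by ring,
        Real.sqrt_mul (by positivity), Real.sqrt_sq (by positivity), Real.sqrt_mul hX0.le]
      ring
    have e2 : X ^ σ * X ^ (1 / 2 - σ) * √X = X := by
      rw [Real.sqrt_eq_rpow, ← Real.rpow_add hX0, ← Real.rpow_add hX0,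
        show σ + (1 / 2 - σ) + 1 / 2 = 1 by ring, Real.rpow_one]
    have e3 : √(κ * ((1 - D.w) * D.mass σ) * A) = √κ * √((1 - D.w) * D.mass σ * A) := by
      rw [← Real.sqrt_mul hκ0]; congr 1; ring
    rw [e1, e3, hYX]
    calc _ = 2 * Real.pi * ((X ^ σ * X ^ (1 / 2 - σ) * √X) * Real.log T ^ ℓ *
          (√κ * √((1 - D.w) * D.mass σ * A))) := by ring
      _ = _ := by rw [e2]
  rw [hrhs] at hineq
  rw [hA1] at hSge
  have hlog : Real.log (z₀ * X / D.N) =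
      Real.log T * (1 + Real.log (z₀ / (2 * Real.pi * D.N)) * (Real.log T)⁻¹) := by
    have : z₀ * X / D.N = T * (z₀ / (2 * Real.pi * D.N)) := by rw [hXdef]; field_simp
    rw [this, Real.log_mul hT0.ne' (by positivity)]
    field_simp
  set c₁ := ∑ m ∈ Finset.Icc 1 D.N, c m
  set d := Real.log (z₀ / (2 * Real.pi * D.N))
  have hmul := mul_lt_mul_of_pos_left hT5
    (show 0 < 2 * Real.pi * (X * Real.log T ^ ℓ) by positivity)
  have hX34 : X ^ (3 / 4 : ℝ) = X * (X ^ (1 / 4 : ℝ))⁻¹ := by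
    rw [← Real.rpow_neg hX0.le]
    nth_rewrite 2 [← Real.rpow_one X]
    rw [← Real.rpow_add hX0]; norm_num
  have hfin : 2 * Real.pi * (X * Real.log T ^ ℓ) * ((1 + d * (Real.log T)⁻¹) ^ ℓ *
      ((z₁ - z₀) * A - c₁ * X⁻¹) -
      C / (2 * Real.pi) * ((X ^ (1 / 4 : ℝ))⁻¹ * ((Real.log T)⁻¹) ^ ℓ)) =
      2 * Real.pi * (Real.log (z₀ * X / D.N) ^ ℓ * ((z₁ - z₀) * A * X - c₁)) -
        C * X ^ (3 / 4 : ℝ) := by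
    have e1 : Real.log T ^ ℓ * ((Real.log T)⁻¹) ^ ℓ = 1 := by
      rw [← mul_pow, mul_inv_cancel₀ hL0.ne', one_pow]
    have e2 : X * X⁻¹ = 1 := mul_inv_cancel₀ hX0.ne'
    have e3 : 2 * Real.pi * (C / (2 * Real.pi)) = C := by field_simp
    rw [hlog, mul_pow, hX34]
    calc _ = 2 * Real.pi * (Real.log T ^ ℓ * (1 + d * (Real.log T)⁻¹) ^ ℓ *
          ((z₁ - z₀) * A * X - c₁ * (X * X⁻¹))) - (2 * Real.pi * (C / (2 * Real.pi))) *
          (X * (X ^ (1 / 4 : ℝ))⁻¹) * (Real.log T ^ ℓ * ((Real.log T)⁻¹) ^ ℓ) := by ring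
      _ = _ := by rw [e1, e2, e3]; ring
  rw [hfin] at hmul
  have hS1 : 2 * Real.pi * (Real.log (z₀ * X / D.N) ^ ℓ * ((z₁ - z₀) * A * X - c₁)) ≤
      2 * Real.pi * |S| := by
    have := hSge.trans (le_abs_self S)
    gcongr
  linarith

theorem mainTheorem5 (ℓ : ℕ) (β : ℝ) (hβ₀ : 0 ≤ β) (hβ₁ : β < 1) (σ : ℝ) (hσ : σ < 1 / 2) :
    ∃ M ε : ℝ → ℝ,
      (∀ T : ℝ, 1 ≤ T →
        IsGreatest ((fun t : ℝ => ‖iteratedDeriv ℓ riemannZeta ((σ : ℂ) + (t : ℂ) * Complex.I)‖) ''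
          Icc (T ^ β) T) (M T)) ∧
      Tendsto ε atTop (𝓝 0) ∧
      ∀ᶠ T : ℝ in atTop,
        (1 + ε T) * (2 * Real.pi) ^ (σ - 1 / 2) *
            Real.sqrt ((riemannZeta ((2 - 2 * σ : ℝ) : ℂ)).re / (2 - 2 * σ)) *
            T ^ (1 / 2 - σ) * Real.log T ^ ℓ ≤ M T := by
  have hM : ∀ T : ℝ, 1 ≤ T →
      IsGreatest ((fun t : ℝ => ‖iteratedDeriv ℓ riemannZeta ((σ : ℂ) + (t : ℂ) * Complex.I)‖) ''
        Icc (T ^ β) T) (sSup ((fun t : ℝ =>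
          ‖iteratedDeriv ℓ riemannZeta ((σ : ℂ) + (t : ℂ) * Complex.I)‖) '' Icc (T ^ β) T)) := by
    intro T hT
    refine (isCompact_Icc.image
      (continuous_iteratedDeriv_riemannZeta_line ℓ (by linarith)).norm).isGreatest_sSup ?_
    refine (nonempty_Icc.2 ?_).image _
    calc T ^ β ≤ T ^ (1 : ℝ) := Real.rpow_le_rpow_of_exponent_le hT hβ₁.le
      _ = T := Real.rpow_one T
  -- The error function may be taken to be zero.
  refine ⟨_, fun _ => 0, hM, tendsto_const_nhds, ?_⟩
  simpa using eventually_le_of_isGreatest ℓ hβ₁ hσ hM
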